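/- **Arcs.** A positively oriented arc is a path $\gamma(t)=c+r(\cos(2\pi a t+t_1),\sin(2\pi a t+t_1))$, $t\in[0,1]$, with $c\in\mathbb R^2$, $r>0$, $a\in(0,1)$, $t_1\in[0,2\pi)$; a negatively oriented arc is the reverse path $t\mapsto\gamma(1-t)$ of one; a line segment is a path $t\mapsto(1-t)p_1+tp_2$ with $p_1\ne p_2$. An arc is a path of one of these three kinds. For an arc $\gamma$ we also write $\gamma$ for the point set $\gamma([0,1])$, and we put $\gamma^\circ=\gamma((0,1))$; $[\gamma]=\gamma(\mathbb R)$ is its circle or line, $\gamma'(t)$ its unit tangent vector, and $n_\gamma(t)=(-v,u)$, where $(u,v)=\gamma'(t)$, its left unit normal. A point is strictly left of a positively (negatively) oriented arc if it lies inside (outside) its circle, and strictly left of a segment $\ell$ if $\langle n_\ell(0),x-\ell(0)\rangle>0$; strictly right is defined with the opposite side. For arcs $\alpha,\gamma$ and $t$ with $\alpha(t)\in\gamma^\circ$: $\alpha$ leaves $\gamma$ in $t<1$ to the left (right) if $\alpha(t+\varepsilon)$ is strictly left (right) of $\gamma$ for all sufficiently small $\varepsilon>0$; $\alpha$ approaches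 $\gamma$ in $t>0$ from the left if $\alpha(t-\varepsilon)$ is strictly left of $\gamma$ for all sufficiently small $\varepsilon>0$. $\alpha$ cuts $\gamma$ in $t$ from the left if for some $t'\in[0,t]$ we have $\alpha([t',t])\subset\gamma$, $\alpha$ approaches $\gamma$ in $t'$ from the left, and $\alpha$ leaves $\gamma$ in $t$ to the right. **Connecting arcs.** Let $\sigma$ be an arc and $p\in\mathbb R^2\setminus\sigma$. If $p\notin[\sigma]$, let $\Gamma(\sigma,p)$ be the closure, in the set of all arcs with the distance $\sup_{t\in[0,1]}\|\gamma_1(t)-\gamma_2(t)\|$, of the set of arcs $\gamma$ with $\gamma(0)\in\sigma^\circ$, $\gamma\cap\sigma=\{\gamma(0)\}$, $\gamma(1)=p$ that leave $\sigma$ in $0$ to the left. If $p\in[\sigma]$, let $\Gamma(\sigma,p)$ be the set of arcs $\gamma$ ending at $p$ for which $\gamma(0)=\sigma(t)$ and $\langle n_\sigma(t),\gamma'(0)\rangle>0$ for some $t\in[0,1]$, or $\gamma(0)=\sigma(0)$ and $\gamma'(0)=-\sigma'(0)$, or $\gamma(0)=\sigma(1)$ and $\gamma'(0)=\sigma'(1)$.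 The elements of $\Gamma(\sigma,p)$ are called connecting arcs. **Order.** Write $x\prec_\sigma y$ if $x=\sigma(s)$, $y=\sigma(t)$ with $0\le s<t\le1$. For connecting arcs with $\gamma_1(0)\prec_\sigma\gamma_2(0)$ define $\gamma_1\cap_-\gamma_2\subset[0,1]$ as follows. If $\gamma_1(0)\in\gamma_2$, it is $\{0\}$. Otherwise, if $\gamma_2(0)\in\gamma_1$, it is $\{t\}$ with $\gamma_1(t)=\gamma_2(0)$. Otherwise, it is the set of $t$ in which $\gamma_1$ cuts $\gamma_2$ from the left, together with $t=1$ if $\gamma_1'(1)=\gamma_2'(1)$ and $\gamma_2(1-\varepsilon)$ is strictly right of $\gamma_1$ for all sufficiently small $\varepsilon>0$. For connecting arcs put $\gamma_1\le\gamma_2$ if one of the following holds: 1. $\gamma_1(0)\prec_\sigma\gamma_2(0)$ and $\gamma_1\cap_-\gamma_2=\emptyset$; 2. $\gamma_2(0)\prec_\sigma\gamma_1(0)$ and $\gamma_2\cap_-\gamma_1\neq\emptyset$; 3. $\gamma_1(0)=\gamma_2(0)=\sigma(t^*)$ and $\langle\sigma'(t^*),\gamma_1'(0)\rangle\le\langle\sigma'(t^*),\gamma_2'(0)\rangle$.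 A maximal connecting arc is an element $\gamma\in\Gamma(\sigma,p)$ such that $\gamma'\le\gamma$ for all $\gamma'\in\Gamma(\sigma,p)$, and such that $\gamma\le\gamma'$ with $\gamma'\in\Gamma(\sigma,p)$ implies $\gamma'=\gamma$. **Proposition.** Let $\sigma$ be an arc and $p\in\mathbb R^2\setminus\sigma$. (a) Suppose that $p$ is strictly left of $\sigma$ or $p\in[\sigma]$, and that $\sigma'(1)\ne(\sigma(1)-p)/\|\sigma(1)-p\|$. Then there is exactly one arc with starting point $\sigma(1)$, unit tangent $\sigma'(1)$ at the start, and endpoint $p$, and it is the maximal connecting arc in $\Gamma(\sigma,p)$ with respect to $\le$. (b) Suppose that $p$ is strictly right of $\sigma$, that $p$ is not on the line segment from $\sigma(0)$ to $\sigma(1)$, and that $\sigma(0)$ is not on the line segment from $p$ to $\sigma(1)$. Then there is exactly one arc with starting point $\sigma(0)$ and endpoint $p$ that passes through $\sigma(1)$, and it is the maximal connecting arc in $\Gamma(\sigma,p)$ with respect to $\le$. -/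

import Mathlib

open Set Filter Topology

namespace CircVis

/-- Arcs in the Euclidean plane, the plane being identified with `ℂ` (with its real inner product).
An arc is a positively oriented circular arc, the reverse path of a positively oriented circular
arc, or a line segment; see `Arc.path` for the paths. -/
inductive Arc : Type
  | pos (c : ℂ) (r a t₁ : ℝ) (hr : 0 < r) (ha : a ∈ Ioo (0 : ℝ) 1)
      (ht : t₁ ∈ Ico (0 : ℝ) (2 * Real.pi)) : Arc
  | neg (c : ℂ) (r a t₁ : ℝ) (hr : 0 < r) (ha : a ∈ Ioo (0 : ℝ) 1)
      (ht : t₁ ∈ Ico (0 : ℝ) (2 * Real.pi)) : Arc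
  | seg (p₁ p₂ : ℂ) (h : p₁ ≠ p₂) : Arc

/-- The point `c + r (cos (2 π a t + t₁), sin (2 π a t + t₁))`. -/
noncomputable def circlePath (c : ℂ) (r a t₁ t : ℝ) : ℂ :=
  c + (r : ℂ) * Complex.exp (((2 * Real.pi * a * t + t₁ : ℝ) : ℂ) * Complex.I)

namespace Arc

/-- The path of an arc. The path proper is its restriction to `[0, 1]`; the same formula gives the
extension to `ℝ` that parametrizes the corresponding circle or line. -/
noncomputable def path : Arc → ℝ → ℂ
  | pos c r a t₁ _ _ _, t => circlePath c r a t₁ t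
  | neg c r a t₁ _ _ _, t => circlePath c r a t₁ (1 - t)
  | seg p₁ p₂ _, t => ((1 - t : ℝ) : ℂ) * p₁ + (t : ℂ) * p₂

noncomputable instance : CoeFun Arc (fun _ => ℝ → ℂ) := ⟨Arc.path⟩

/-- The point set of the arc. -/
def image (γ : Arc) : Set ℂ := γ '' Icc (0 : ℝ) 1

/-- The point set of the arc without its two endpoints. -/
def inner (γ : Arc) : Set ℂ := γ '' Ioo (0 : ℝ) 1

/-- The corresponding circle or line `[γ] = γ(ℝ)`. -/
def carrier (γ : Arc) : Set ℂ := range γ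

/-- The unit tangent vector. -/
noncomputable def tangent (γ : Arc) (t : ℝ) : ℂ :=
  (‖deriv γ t‖⁻¹ : ℝ) • deriv γ t

/-- The unit normal to the left: `(-v, u)` if `(u, v)` is the unit tangent vector. -/
noncomputable def normal (γ : Arc) (t : ℝ) : ℂ := Complex.I * γ.tangent t

/-- `x` is strictly left of the arc: inside the circle of a positively oriented arc, outside the
circle of a negatively oriented one, in the open left half-plane of a line segment. -/
def StrictlyLeft (x : ℂ) : Arc → Prop
  | pos c r _ _ _ _ _ => ‖x - c‖ < r
  | neg c r _ _ _ _ _ => r < ‖x - c‖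
  | seg p₁ p₂ h => 0 < Inner.inner ℝ ((seg p₁ p₂ h).normal 0) (x - p₁)

/-- `x` is strictly right of the arc. -/
def StrictlyRight (x : ℂ) : Arc → Prop
  | pos c r _ _ _ _ _ => r < ‖x - c‖
  | neg c r _ _ _ _ _ => ‖x - c‖ < r
  | seg p₁ p₂ h => Inner.inner ℝ ((seg p₁ p₂ h).normal 0) (x - p₁) < 0

/-- `α` leaves `γ` in `t` to the left. -/
def LeavesLeft (α γ : Arc) (t : ℝ) : Prop :=
  t ∈ Ico (0 : ℝ) 1 ∧ α t ∈ γ.inner ∧ ∀ᶠ ε in 𝓝[>] (0 : ℝ), StrictlyLeft (α (t + ε)) γ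

/-- `α` leaves `γ` in `t` to the right. -/
def LeavesRight (α γ : Arc) (t : ℝ) : Prop :=
  t ∈ Ico (0 : ℝ) 1 ∧ α t ∈ γ.inner ∧ ∀ᶠ ε in 𝓝[>] (0 : ℝ), StrictlyRight (α (t + ε)) γ

/-- `α` approaches `γ` in `t` from the left. -/
def ApproachesLeft (α γ : Arc) (t : ℝ) : Prop :=
  t ∈ Ioc (0 : ℝ) 1 ∧ α t ∈ γ.inner ∧ ∀ᶠ ε in 𝓝[>] (0 : ℝ), StrictlyLeft (α (t - ε)) γ

/-- The set of parameters in which `α` cuts `γ` from the left. -/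
def cutsFromLeft (α γ : Arc) : Set ℝ :=
  {t | t ∈ Icc (0 : ℝ) 1 ∧ ∃ t' ∈ Icc (0 : ℝ) t,
    (∀ s ∈ Icc t' t, α s ∈ γ.image) ∧ α.ApproachesLeft γ t' ∧ α.LeavesRight γ t}

/-- `x` comes strictly before `y` on the arc `σ`. -/
def Prec (σ : Arc) (x y : ℂ) : Prop :=
  ∃ s ∈ Icc (0 : ℝ) 1, ∃ t ∈ Icc (0 : ℝ) 1, σ s = x ∧ σ t = y ∧ s < t

/-- The connecting arcs in the narrow sense, for `p` off the circle or line of `σ`. -/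
def connectingStar (σ : Arc) (p : ℂ) : Set Arc :=
  {γ | γ 0 ∈ σ.inner ∧ γ.image ∩ σ.image = {γ 0} ∧ γ 1 = p ∧ γ.LeavesLeft σ 0}

/-- The closure, within the set of all arcs, for the distance
`d(γ₁, γ₂) = sup_{t ∈ [0, 1]} ‖γ₁ t - γ₂ t‖`. -/
def arcClosure (S : Set Arc) : Set Arc :=
  {γ | ∀ ε > 0, ∃ γ' ∈ S, ∀ t ∈ Icc (0 : ℝ) 1, ‖γ t - γ' t‖ < ε}

/-- `γ` is the arc with starting point `x`, endpoint `y` and unit tangent `τ` at the start. -/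
def IsArcWithTangent (τ x y : ℂ) (γ : Arc) : Prop :=
  γ 0 = x ∧ γ 1 = y ∧ γ.tangent 0 = τ

/-- `γ` is the arc with starting point `x` and endpoint `y` that passes through `z`. -/
def IsArcThrough (x z y : ℂ) (γ : Arc) : Prop :=
  γ 0 = x ∧ γ 1 = y ∧ z ∈ γ.image

/-- The set of connecting arcs from `σ` to `p`. -/
def connecting (σ : Arc) (p : ℂ) : Set Arc :=
  {γ | (p ∉ σ.carrier ∧ γ ∈ arcClosure (σ.connectingStar p)) ∨
    (p ∈ σ.carrier ∧
      ((∃ t ∈ Icc (0 : ℝ) 1, ∃ τ : ℂ, ‖τ‖ = 1 ∧ 0 < Inner.inner ℝ (σ.normal t) τ ∧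
          IsArcWithTangent τ (σ t) p γ) ∨
        IsArcWithTangent (-σ.tangent 0) (σ 0) p γ ∨
        IsArcWithTangent (σ.tangent 1) (σ 1) p γ))}

/-- The set of parameters in which `γ₁` cuts `γ₂` from the left, in the extended sense for
connecting arcs `γ₁`, `γ₂` with a common endpoint such that `γ₁` starts before `γ₂` on the
starting arc: it is `{0}` if `γ₁` starts on `γ₂`; otherwise the parameter of `γ₂ 0` on `γ₁` if `γ₂`
starts on `γ₁`; otherwise it consists of the cuts proper and of the parameter `1` if the two arcs
have the same final tangent and `γ₂` approaches the circle or line of `γ₁` in `1` from the right. -/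
def extCutsFromLeft (γ₁ γ₂ : Arc) : Set ℝ :=
  {t | (γ₁ 0 ∈ γ₂.image ∧ t = 0) ∨
    (γ₁ 0 ∉ γ₂.image ∧ γ₂ 0 ∈ γ₁.image ∧ t ∈ Icc (0 : ℝ) 1 ∧ γ₁ t = γ₂ 0) ∨
    (γ₁ 0 ∉ γ₂.image ∧ γ₂ 0 ∉ γ₁.image ∧
      (t ∈ γ₁.cutsFromLeft γ₂ ∨
        (t = 1 ∧ γ₁.tangent 1 = γ₂.tangent 1 ∧
          ∀ᶠ ε in 𝓝[>] (0 : ℝ), StrictlyRight (γ₂ (1 - ε)) γ₁)))}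

/-- The relation `γ₁ ≤ γ₂` on the connecting arcs of `σ`. -/
def ConnLE (σ γ₁ γ₂ : Arc) : Prop :=
  (σ.Prec (γ₁ 0) (γ₂ 0) ∧ γ₁.extCutsFromLeft γ₂ = ∅) ∨
  (σ.Prec (γ₂ 0) (γ₁ 0) ∧ γ₂.extCutsFromLeft γ₁ ≠ ∅) ∨
  (∃ t ∈ Icc (0 : ℝ) 1, γ₁ 0 = σ t ∧ γ₂ 0 = σ t ∧
    Inner.inner ℝ (σ.tangent t) (γ₁.tangent 0) ≤ Inner.inner ℝ (σ.tangent t) (γ₂.tangent 0))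

/-- `γ` is the maximal connecting arc from `σ` to `p`: it is a connecting arc, it is greater than
or equal to each connecting arc, and it is the only one with this property. -/
def IsMaximalConnecting (σ : Arc) (p : ℂ) (γ : Arc) : Prop :=
  γ ∈ σ.connecting p ∧ (∀ γ' ∈ σ.connecting p, σ.ConnLE γ' γ) ∧
    ∀ γ' ∈ σ.connecting p, σ.ConnLE γ γ' → γ' = γ

end Arc

end CircVis

namespace CircVis

open ComplexConjugate

/-! An arc is determined by its endpoints and by half its signed opening angle φ ∈ (-π, π), with φ =
0 for segments. In these terms the three kinds of arcs share one Bézier form (`Arc.path_eq`), with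
real weights `wt t` = sin(φt)/sin φ and `wt (1 - t)` whose ratio increases strictly on [0, 1) from 0
to ∞. Sidedness is the sign of the imaginary part of one expression `Arc.side`, and the arc itself
is the set where `side` is real and nonpositive (`Arc.mem_image_iff`). Along another arc, `side` is
a quadratic form in the two weights (`Arc.side_path`). If an endpoint of that arc lies on the circle
or line in question, the imaginary part splits into a weight times a linear form. Crossing questions
thus reduce to the sign change of a linear function of the weight ratio.

(a) The tangential arc γ has no point of σ strictly to its left and meets σ only in σ(1)
(`Arc.side_tangential`). A connecting arc with an earlier start ends where γ ends and starts not
strictly left of γ, so its linear form cannot go from positive to zero: it never cuts γ from the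
left. Among the arcs from σ(1), the direction σ'(1) alone has the greatest inner product with
itself. If p is off [σ], then γ is the limit of the arcs tangent to σ at σ(1 - s).

(b) The circle or line of γ lies in the pencil through σ(0) and σ(1), so its sides can be read off
from those of σ (`Arc.side_im_through`). A narrow connecting arc passes to the right of σ only by
crossing [σ] off σ, which happens left of γ. The resulting alternative is a closed condition and
survives in the closure. Hence a connecting arc from an inner point of σ, which starts right of γ,
meets γ (`Arc.exists_meet`), and γ then cuts it from the left. Among the arcs from σ(0), γ makes the
smallest angle with σ'(0) (`Arc.inner_le_of_cross`). The arc γ is the limit of the arcs from σ(s)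
through σ(1 + s). -/

/-- The unit complex number `exp (i θ)`. -/
noncomputable def cis (θ : ℝ) : ℂ := Complex.exp (θ * Complex.I)

@[simp] lemma cis_zero : cis 0 = 1 := by simp [cis]

lemma cis_add (x y : ℝ) : cis (x + y) = cis x * cis y := by
  simp [cis, add_mul, Complex.exp_add]

lemma conj_cis (x : ℝ) : conj (cis x) = cis (-x) := by
  simp [cis, ← Complex.exp_conj]

lemma cis_mul_cis_neg (x : ℝ) : cis x * cis (-x) = 1 := by
  rw [← cis_add]; simp

lemma cis_ne_zero (x : ℝ) : cis x ≠ 0 := Complex.exp_ne_zero _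

@[simp] lemma norm_cis (x : ℝ) : ‖cis x‖ = 1 := Complex.norm_exp_ofReal_mul_I x

lemma cis_eq (x : ℝ) : cis x = Real.cos x + Real.sin x * Complex.I := by
  simp [cis, Complex.exp_mul_I]

lemma im_cis (x : ℝ) : (cis x).im = Real.sin x := Complex.exp_ofReal_mul_I_im x

lemma continuous_cis : Continuous cis := by
  unfold cis; fun_prop

lemma norm_mul_cis_arg (z : ℂ) : (‖z‖ : ℂ) * cis z.arg = z := Complex.norm_mul_exp_arg_mul_I z

/-- Two angles that differ by less than a full turn and have the same `cis` are equal. -/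
lemma cis_injOn {x y : ℝ} (h : cis x = cis y) (hd : |x - y| < 2 * Real.pi) : x = y := by
  unfold cis at h
  obtain ⟨n, hn⟩ := Complex.exp_eq_exp_iff_exists_int.1 h
  have h2 : x = y + n * (2 * Real.pi) := by
    have := congrArg Complex.im hn
    simpa using this
  have hp := Real.pi_pos
  have h3 : |(n : ℝ)| < 1 := by
    have : x - y = n * (2 * Real.pi) := by linarith
    rw [this, abs_mul, abs_of_pos (by positivity : 0 < 2 * Real.pi)] at hd
    nlinarith
  have h4 : n = 0 := by
    have : |n| < 1 := by exact_mod_cast h3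
    exact Int.abs_lt_one_iff.1 this
  simp [h2, h4]

/-! ### The sine weights. -/

/-- The ratio `sin (φ t) / sin φ`, extended by `t` to `φ = 0`. -/
noncomputable def sinRatio (φ t : ℝ) : ℝ := t * Real.sinc (φ * t) / Real.sinc φ

lemma sinRatio_zero_left (t : ℝ) : sinRatio 0 t = t := by simp [sinRatio]

lemma sinRatio_of_ne {φ : ℝ} (h : φ ≠ 0) (t : ℝ) :
    sinRatio φ t = Real.sin (φ * t) / Real.sin φ := by
  unfold sinRatio
  rw [Real.sinc_of_ne_zero h]
  by_cases ht : t = 0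
  · simp [ht]
  · rw [Real.sinc_of_ne_zero (mul_ne_zero h ht)]
    field_simp

@[simp] lemma sinRatio_zero (φ : ℝ) : sinRatio φ 0 = 0 := by simp [sinRatio]

lemma sinRatio_neg (φ t : ℝ) : sinRatio φ (-t) = -sinRatio φ t := by
  simp [sinRatio, Real.sinc_neg, neg_div]

lemma sinc_pos {x : ℝ} (h : |x| < Real.pi) : 0 < Real.sinc x := by
  rcases eq_or_ne x 0 with rfl | hx
  · simp
  rw [Real.sinc_of_ne_zero hx]
  rw [abs_lt] at h
  rcases lt_or_gt_of_ne hx with h0 | h0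
  · exact div_pos_of_neg_of_neg (Real.sin_neg_of_neg_of_neg_pi_lt h0 h.1) h0
  · exact div_pos (Real.sin_pos_of_pos_of_lt_pi h0 h.2) h0

lemma continuous_sinRatio (φ : ℝ) : Continuous (sinRatio φ) := by
  unfold sinRatio
  have := Real.continuous_sinc
  fun_prop

section
variable {φ : ℝ} (hφ : |φ| < Real.pi)
include hφ

lemma sin_ne_zero_of_abs_lt (h : φ ≠ 0) : Real.sin φ ≠ 0 := by
  have := (sinc_pos hφ).ne'
  rw [Real.sinc_of_ne_zero h] at this
  exact fun h' => this (by simp [h'])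

lemma sinRatio_one : sinRatio φ 1 = 1 := by
  have := (sinc_pos hφ).ne'
  simp [sinRatio, this]

lemma sinRatio_pos {t : ℝ} (h0 : 0 < t) (h : |φ * t| < Real.pi) : 0 < sinRatio φ t :=
  div_pos (mul_pos h0 (sinc_pos h)) (sinc_pos hφ)

lemma abs_mul_lt_pi {t : ℝ} (h : |t| ≤ 1) : |φ * t| < Real.pi := by
  rw [abs_mul]
  exact lt_of_le_of_lt (mul_le_of_le_one_right (abs_nonneg _) h) hφ

lemma sinRatio_pos' {t : ℝ} (h0 : 0 < t) (h1 : t ≤ 1) : 0 < sinRatio φ t :=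
  sinRatio_pos hφ h0 (abs_mul_lt_pi hφ (by rw [abs_of_pos h0]; exact h1))

lemma sinRatio_nonneg {t : ℝ} (h0 : 0 ≤ t) (h1 : t ≤ 1) : 0 ≤ sinRatio φ t := by
  rcases h0.eq_or_lt with rfl | h0
  · simp
  · exact (sinRatio_pos' hφ h0 h1).le

/-- This is the addition theorem for the sine. Positivity of the right side makes the ratio of the
two weights strictly increasing. -/
lemma sinRatio_cross (s t : ℝ) :
    sinRatio φ t * sinRatio φ (1 - s) - sinRatio φ s * sinRatio φ (1 - t) =
      sinRatio φ (t - s) := by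
  rcases eq_or_ne φ 0 with rfl | h
  · simp only [sinRatio_zero_left]; ring
  have h2 := sin_ne_zero_of_abs_lt hφ h
  simp only [sinRatio_of_ne h, mul_sub, mul_one, Real.sin_sub]
  field_simp
  ring

/-- The two complex Bézier coefficients of an arc add up to 1, so the Bézier form is compatible with
translations. -/
lemma cis_sinRatio (t : ℝ) :
    cis (φ * t) * sinRatio φ (1 - t) + cis (φ * (t - 1)) * sinRatio φ t = 1 := by
  rcases eq_or_ne φ 0 with rfl | h
  · simp [sinRatio_zero_left]
  have h2 := sin_ne_zero_of_abs_lt hφ h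
  simp only [sinRatio_of_ne h, mul_sub, mul_one, Real.sin_sub, cis_eq, Real.cos_sub]
  have h3 : (Real.sin φ : ℂ) ≠ 0 := by exact_mod_cast h2
  push_cast at h3 ⊢
  field_simp
  linear_combination (Complex.sin φ) * (Complex.sin_sq_add_cos_sq (φ * t))

lemma cis_eq_sinRatio (t : ℝ) :
    cis (φ * t) = sinRatio φ (1 - t) + cis φ * sinRatio φ t := by
  have h := congrArg conj (cis_sinRatio hφ t)
  simp only [map_add, map_mul, conj_cis, Complex.conj_ofReal, map_one] at h
  have e : cis (-(φ * (t - 1))) = cis φ * cis (-(φ * t)) := by rw [← cis_add]; ring_nf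
  rw [e] at h
  linear_combination (-cis (φ * t)) * h +
    (sinRatio φ (1 - t) + cis φ * sinRatio φ t) * cis_mul_cis_neg (φ * t)

/-- Every nonnegative ratio `sinRatio φ t / sinRatio φ (1 - t)` is attained in `[0, 1)`. -/
lemma exists_sinRatio_eq {l : ℝ} (hl : 0 ≤ l) :
    ∃ t ∈ Ico (0 : ℝ) 1, sinRatio φ t = l * sinRatio φ (1 - t) := by
  have hc : ContinuousOn (fun t => sinRatio φ t - l * sinRatio φ (1 - t)) (Icc 0 1) := by
    have := continuous_sinRatio φ
    fun_prop
  have := intermediate_value_Icc (zero_le_one) hc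
  have h0 : (0 : ℝ) ∈ Icc (sinRatio φ 0 - l * sinRatio φ (1 - 0))
      (sinRatio φ 1 - l * sinRatio φ (1 - 1)) := by
    simp [sinRatio_one hφ, hl]
  obtain ⟨t, ht, h⟩ := this h0
  refine ⟨t, ⟨ht.1, lt_of_le_of_ne ht.2 ?_⟩, by simpa [sub_eq_zero] using h⟩
  rintro rfl
  simp [sinRatio_one hφ] at h

end

/-! ### Centre, radius and phase of a circular arc. -/

lemma mul_neg_iff_of_pos {a b : ℝ} (h : 0 < b) : a * b < 0 ↔ a < 0 :=
  ⟨fun h' => by by_contra! h2; exact absurd (mul_nonneg h2 h.le) (not_le.2 h'),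
    fun h' => mul_neg_of_neg_of_pos h' h⟩

/-- Subtracting the two equations eliminates the centres and leaves the radius vectors times `cis ω
- 1`, which is nonzero because the arc is not a full turn. -/
lemma circle_data_unique {c c' : ℂ} {r r' t t' ω : ℝ} (hr : 0 < r) (hr' : 0 < r')
    (ht : t ∈ Ico 0 (2 * Real.pi)) (ht' : t' ∈ Ico 0 (2 * Real.pi)) (hω : ω ∈ Ioo 0 (2 * Real.pi))
    (h0 : c + r * cis t = c' + r' * cis t')
    (h1 : c + r * cis (ω + t) = c' + r' * cis (ω + t')) : c = c' ∧ r = r' ∧ t = t' := by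
  have hω1 : cis ω - 1 ≠ 0 := by
    intro h
    have : ω = 0 := cis_injOn (by rw [sub_eq_zero.1 h, cis_zero])
      (by rw [sub_zero, abs_of_pos hω.1]; exact hω.2)
    exact hω.1.ne' this
  have hX : r * cis t = r' * cis t' := by
    rw [cis_add, cis_add] at h1
    apply mul_right_cancel₀ hω1
    linear_combination h1 - h0
  have hrr : r = r' := by
    have := congrArg norm hX
    simpa [abs_of_pos hr, abs_of_pos hr'] using this
  subst hrr
  refine ⟨by linear_combination h0 - hX, rfl, ?_⟩
  refine cis_injOn (mul_left_cancel₀ (by exact_mod_cast hr.ne') hX) ?_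
  rw [abs_lt]
  constructor <;> linarith [ht.1, ht.2, ht'.1, ht'.2]

lemma circlePath_eq (c : ℂ) (r a t₁ t : ℝ) :
    circlePath c r a t₁ t = c + r * cis (2 * Real.pi * a * t + t₁) := rfl

/-- Every nonzero complex number in polar form, with the angle in `[0, 2π)`. -/
lemma exists_polar {X : ℂ} (hX : X ≠ 0) :
    ∃ r : ℝ, 0 < r ∧ ∃ t ∈ Ico 0 (2 * Real.pi), X = r * cis t := by
  have hp := Real.pi_pos
  refine ⟨‖X‖, norm_pos_iff.2 hX, ?_⟩
  rcases le_or_gt 0 X.arg with h | h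
  · exact ⟨X.arg, ⟨h, by linarith [Complex.arg_le_pi X]⟩, (norm_mul_cis_arg X).symm⟩
  · refine ⟨X.arg + 2 * Real.pi, ⟨by linarith [Complex.neg_pi_lt_arg X], by linarith⟩, ?_⟩
    have : cis (2 * Real.pi) = 1 := by simp [cis, Complex.exp_two_pi_mul_I]
    rw [cis_add, this, mul_one, norm_mul_cis_arg]

namespace Arc

/-! ### A uniform description of the three kinds of arcs. -/

/-- Half the signed opening angle of an arc. -/
noncomputable def ang : Arc → ℝ
  | pos _ _ a _ _ _ _ => Real.pi * a
  | neg _ _ a _ _ _ _ => -(Real.pi * a)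
  | seg _ _ _ => 0

lemma abs_ang_lt (γ : Arc) : |γ.ang| < Real.pi := by
  have hp := Real.pi_pos
  rcases γ with ⟨c, r, a, t₁, hr, ha, ht⟩ | ⟨c, r, a, t₁, hr, ha, ht⟩ | ⟨p₁, p₂, h⟩
  · simp only [ang]
    rw [abs_of_pos (mul_pos hp ha.1)]
    nlinarith [ha.2]
  · simp only [ang]
    rw [abs_neg, abs_of_pos (mul_pos hp ha.1)]
    nlinarith [ha.2]
  · simpa [ang] using hp

/-- A circular arc runs with angular velocity twice its half opening angle. -/
lemma path_of_circle (γ : Arc) :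
    (γ.ang = 0 ∧ ∀ t : ℝ, γ t = (1 - t) * γ 0 + t * γ 1) ∨
    (γ.ang ≠ 0 ∧ ∃ c X : ℂ, X ≠ 0 ∧ (∀ t, γ t = c + X * cis (2 * γ.ang * t)) ∧
      (∀ z, StrictlyLeft z γ ↔ 0 < (‖X‖ ^ 2 - ‖z - c‖ ^ 2) * Real.sin γ.ang) ∧
      (∀ z, StrictlyRight z γ ↔ (‖X‖ ^ 2 - ‖z - c‖ ^ 2) * Real.sin γ.ang < 0)) := by
  have hp := Real.pi_pos
  rcases γ with ⟨c, r, a, t₁, hr, ha, ht⟩ | ⟨c, r, a, t₁, hr, ha, ht⟩ | ⟨p₁, p₂, h⟩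
  · right
    have hs : 0 < Real.sin (Real.pi * a) :=
      Real.sin_pos_of_pos_of_lt_pi (mul_pos hp ha.1) (by nlinarith [ha.2])
    refine ⟨(mul_pos hp ha.1).ne', c, r * cis t₁,
      mul_ne_zero (by exact_mod_cast hr.ne') (cis_ne_zero _), ?_, ?_, ?_⟩
    · intro t
      simp only [path, circlePath, ang, mul_assoc, ← cis_add]
      rw [cis]
      ring_nf
    · intro z
      simp only [StrictlyLeft, ang, mul_pos_iff_of_pos_right hs, norm_mul, norm_cis, mul_one,
        Complex.norm_real, Real.norm_eq_abs, abs_of_pos hr, sub_pos]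
      exact (pow_lt_pow_iff_left₀ (norm_nonneg _) hr.le two_ne_zero).symm
    · intro z
      simp only [StrictlyRight, ang, mul_neg_iff_of_pos hs, norm_mul, norm_cis, mul_one,
        Complex.norm_real, Real.norm_eq_abs, abs_of_pos hr, sub_neg]
      exact (pow_lt_pow_iff_left₀ hr.le (norm_nonneg _) two_ne_zero).symm
  · right
    have hs : 0 < Real.sin (Real.pi * a) :=
      Real.sin_pos_of_pos_of_lt_pi (mul_pos hp ha.1) (by nlinarith [ha.2])
    refine ⟨(neg_neg_of_pos (mul_pos hp ha.1)).ne, c, r * cis (2 * Real.pi * a + t₁),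
      mul_ne_zero (by exact_mod_cast hr.ne') (cis_ne_zero _), ?_, ?_, ?_⟩
    · intro t
      simp only [path, circlePath, ang, mul_assoc, ← cis_add]
      rw [cis]
      ring_nf
    · intro z
      simp only [StrictlyLeft, ang, Real.sin_neg, norm_mul, norm_cis, mul_one, mul_neg, neg_pos,
        Complex.norm_real, Real.norm_eq_abs, abs_of_pos hr, mul_neg_iff_of_pos hs, sub_neg]
      exact (pow_lt_pow_iff_left₀ hr.le (norm_nonneg _) two_ne_zero).symm
    · intro z
      simp only [StrictlyRight, ang, Real.sin_neg, norm_mul, norm_cis, mul_one, mul_neg,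
        Complex.norm_real, Real.norm_eq_abs, abs_of_pos hr, neg_neg_iff_pos,
        mul_pos_iff_of_pos_right hs, sub_pos]
      exact (pow_lt_pow_iff_left₀ (norm_nonneg _) hr.le two_ne_zero).symm
  · left
    refine ⟨rfl, fun t => ?_⟩
    simp [path]

lemma path_eq (γ : Arc) (t : ℝ) :
    γ t = γ 0 * (cis (γ.ang * t) * sinRatio γ.ang (1 - t)) +
      γ 1 * (cis (γ.ang * (t - 1)) * sinRatio γ.ang t) := by
  rcases γ.path_of_circle with ⟨h, h'⟩ | ⟨h, c, X, hX, h', -, -⟩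
  · rw [h, h' t]
    simp [sinRatio_zero_left, mul_comm]
  · rw [h' t, h' 0, h' 1]
    simp only [mul_zero, mul_one, cis_zero]
    have e1 := cis_sinRatio γ.abs_ang_lt t
    have e2 := cis_eq_sinRatio γ.abs_ang_lt t
    have e3 : cis (2 * γ.ang * t) = cis (γ.ang * t) * cis (γ.ang * t) := by
      rw [← cis_add]; ring_nf
    have e4 : cis (2 * γ.ang) * cis (γ.ang * (t - 1)) = cis (γ.ang * t) * cis (γ.ang) := by
      simp only [← cis_add]; ring_nf
    rw [e3]
    linear_combination -c * e1 + X * cis (γ.ang * t) * e2 - X * sinRatio γ.ang t * e4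

lemma start_ne_end (γ : Arc) : γ 0 ≠ γ 1 := by
  rcases γ with ⟨c, r, a, t₁, hr, ha, ht⟩ | ⟨c, r, a, t₁, hr, ha, ht⟩ | ⟨p₁, p₂, h⟩
  rotate_left 2
  · simpa [path] using h
  all_goals
    intro h
    have hp := Real.pi_pos
    have hr' : (r : ℂ) ≠ 0 := by exact_mod_cast hr.ne'
    simp only [path, circlePath, add_right_inj, mul_eq_mul_left_iff, hr', or_false] at h
    have := cis_injOn (x := _) (y := _) h (by
      ring_nf
      rw [abs_lt]
      constructor <;> nlinarith [ha.1, ha.2])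
    nlinarith [ha.1]

/-- The direction of motion turns uniformly, from `-ang` to `ang` relative to the chord, and is
parallel to the chord at the midpoint. -/
lemma hasDerivAt_path (γ : Arc) (t : ℝ) :
    HasDerivAt γ.path
      (((Real.sinc γ.ang)⁻¹ : ℝ) • ((γ 1 - γ 0) * cis (γ.ang * (2 * t - 1)))) t := by
  have e : HasDerivAt (fun t : ℝ => (t : ℂ)) 1 t := Complex.ofRealCLM.hasDerivAt
  rcases γ.path_of_circle with ⟨h, h'⟩ | ⟨h, c, X, hX, h', -, -⟩
  · have e1 : HasDerivAt (fun t : ℝ => (1 - t) * γ 0 + t * γ 1)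
        ((0 - 1) * γ 0 + 1 * γ 1) t :=
      (((hasDerivAt_const t (1 : ℂ)).sub e).mul_const (γ 0)).add (e.mul_const (γ 1))
    rw [← show γ.path = fun t : ℝ => (1 - t) * γ 0 + t * γ 1 from funext h'] at e1
    refine e1.congr_deriv ?_
    simp [h]
    ring
  · have e1 : HasDerivAt (fun t : ℝ => c + X * cis (2 * γ.ang * t))
        (X * (cis (2 * γ.ang * t) * (2 * γ.ang * Complex.I))) t := by
      have := (((e.const_mul (2 * γ.ang : ℂ)).mul_const Complex.I).cexp.const_mul X).const_add c
      simp only [cis]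
      push_cast
      simpa only [mul_one] using this
    rw [← show γ.path = fun t : ℝ => c + X * cis (2 * γ.ang * t) from funext h'] at e1
    refine e1.congr_deriv ?_
    rw [Real.sinc_of_ne_zero h, h' 0, h' 1, inv_div]
    have hs := sin_ne_zero_of_abs_lt γ.abs_ang_lt h
    have e2 : cis (2 * γ.ang * t) = cis (γ.ang * (2 * t - 1)) * cis γ.ang := by
      rw [← cis_add]; congr 1; ring
    have e3 : cis (2 * γ.ang * 1) = cis γ.ang * cis γ.ang := by
      rw [← cis_add]; ring_nf
    have e4 : cis γ.ang - cis (-γ.ang) = 2 * Real.sin γ.ang * Complex.I := by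
      rw [cis_eq, cis_eq]; simp; ring
    have e5 := cis_mul_cis_neg γ.ang
    rw [e2, e3]
    have hs' : (Real.sin γ.ang : ℂ) ≠ 0 := by exact_mod_cast hs
    simp only [mul_zero, cis_zero, mul_one, Complex.real_smul, Complex.ofReal_div]
    have e6 : cis γ.ang * cis γ.ang - 1 = cis γ.ang * (2 * Real.sin γ.ang * Complex.I) := by
      rw [← e4]; linear_combination e5
    rw [div_mul_eq_mul_div, eq_div_iff hs']
    linear_combination -γ.ang * X * cis (γ.ang * (2 * t - 1)) * e6

lemma tangent_eq (γ : Arc) (t : ℝ) :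
    γ.tangent t = (‖γ 1 - γ 0‖⁻¹ : ℝ) • ((γ 1 - γ 0) * cis (γ.ang * (2 * t - 1))) := by
  have hs : 0 < (Real.sinc γ.ang)⁻¹ := inv_pos.2 (sinc_pos γ.abs_ang_lt)
  have h0 : ‖γ 1 - γ 0‖ ≠ 0 := norm_ne_zero_iff.2 (sub_ne_zero.2 γ.start_ne_end.symm)
  rw [tangent, (γ.hasDerivAt_path t).deriv, smul_smul, norm_smul, norm_mul, norm_cis, mul_one,
    Real.norm_eq_abs, abs_of_pos hs]
  congr 1
  have := (sinc_pos γ.abs_ang_lt).ne'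
  field_simp

lemma norm_tangent (γ : Arc) (t : ℝ) : ‖γ.tangent t‖ = 1 := by
  have h0 : ‖γ 1 - γ 0‖ ≠ 0 := norm_ne_zero_iff.2 (sub_ne_zero.2 γ.start_ne_end.symm)
  rw [tangent_eq, norm_smul, norm_mul, norm_cis, mul_one, norm_inv, norm_norm]
  field_simp

/-! ### The sides of an arc. -/

/-- The product `(γ 1 - z) * conj (γ 0 - z)`, turned by half the opening angle. Its imaginary part
tells on which side of `γ` the point `z` lies; it is a nonpositive real number on `γ` itself. -/
noncomputable def side (γ : Arc) (z : ℂ) : ℂ := cis (-γ.ang) * (γ 1 - z) * conj (γ 0 - z)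

/-- Up to the factor `-sin ang` this is the power of `z` with respect to the circle. The sign of the
sine accounts for the orientation. -/
lemma side_im_circle {γ : Arc} {c X : ℂ} (h : ∀ t, γ t = c + X * cis (2 * γ.ang * t)) (z : ℂ) :
    (γ.side z).im = (‖X‖ ^ 2 - ‖z - c‖ ^ 2) * Real.sin γ.ang := by
  have e3 : cis (2 * γ.ang * 1) = cis γ.ang * cis γ.ang := by
    rw [← cis_add]; ring_nf
  have e5 := cis_mul_cis_neg γ.ang
  rw [side, h 0, h 1, e3]
  have : cis (-γ.ang) * (c + X * (cis γ.ang * cis γ.ang) - z) * conj (c + X * cis (2 * γ.ang * 0) - z)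
      = X * conj X * cis γ.ang + (z - c) * conj (z - c) * cis (-γ.ang) -
        (X * cis γ.ang * conj (z - c) + conj (X * cis γ.ang * conj (z - c))) := by
    simp only [mul_zero, cis_zero, map_add, map_sub, map_mul, conj_cis, Complex.conj_conj, map_one]
    linear_combination (X * cis γ.ang * (conj c + conj X - conj z)) * e5
  rw [this, Complex.add_conj, Complex.mul_conj, Complex.mul_conj]
  simp only [Complex.sub_im, Complex.add_im, Complex.im_ofReal_mul, im_cis, Real.sin_neg,
    Complex.ofReal_im, Complex.normSq_eq_norm_sq]
  ring

lemma inner_normal_seg (p₁ p₂ : ℂ) (h : p₁ ≠ p₂) (z : ℂ) :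
    Inner.inner ℝ ((seg p₁ p₂ h).normal 0) (z - p₁) = ‖p₂ - p₁‖⁻¹ * ((seg p₁ p₂ h).side z).im := by
  simp only [normal, tangent_eq, side]
  simp only [path, ang]
  simp only [Complex.inner, Complex.real_smul]
  simp
  ring

lemma strictlyLeft_iff (γ : Arc) (z : ℂ) : StrictlyLeft z γ ↔ 0 < (γ.side z).im := by
  rcases γ.path_of_circle with ⟨h, -⟩ | ⟨h, c, X, hX, h', hl, hr⟩
  · rcases γ with ⟨c, r, a, t₁, hr, ha, ht⟩ | ⟨c, r, a, t₁, hr, ha, ht⟩ | ⟨p₁, p₂, h₁⟩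
    · exact absurd h (mul_pos Real.pi_pos ha.1).ne'
    · exact absurd h (neg_neg_of_pos (mul_pos Real.pi_pos ha.1)).ne
    · have h0 : 0 < ‖p₂ - p₁‖⁻¹ := inv_pos.2 (norm_pos_iff.2 (sub_ne_zero.2 h₁.symm))
      rw [StrictlyLeft, inner_normal_seg, mul_pos_iff_of_pos_left h0]
  · rw [hl, side_im_circle h']

lemma strictlyRight_iff (γ : Arc) (z : ℂ) : StrictlyRight z γ ↔ (γ.side z).im < 0 := by
  rcases γ.path_of_circle with ⟨h, -⟩ | ⟨h, c, X, hX, h', hl, hr⟩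
  · rcases γ with ⟨c, r, a, t₁, hr, ha, ht⟩ | ⟨c, r, a, t₁, hr, ha, ht⟩ | ⟨p₁, p₂, h₁⟩
    · exact absurd h (mul_pos Real.pi_pos ha.1).ne'
    · exact absurd h (neg_neg_of_pos (mul_pos Real.pi_pos ha.1)).ne
    · have h0 : 0 < ‖p₂ - p₁‖⁻¹ := inv_pos.2 (norm_pos_iff.2 (sub_ne_zero.2 h₁.symm))
      rw [StrictlyRight, inner_normal_seg, mul_comm, mul_neg_iff_of_pos h0]
  · rw [hr, side_im_circle h']

/-- An arc is determined by its endpoints and its opening angle. -/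
lemma ext_ang {γ δ : Arc} (h0 : γ 0 = δ 0) (h1 : γ 1 = δ 1) (ha : γ.ang = δ.ang) : γ = δ := by
  have hp := Real.pi_pos
  rcases γ with ⟨c, r, a, t₁, hr, ha', ht⟩ | ⟨c, r, a, t₁, hr, ha', ht⟩ | ⟨p₁, p₂, h⟩ <;>
  rcases δ with ⟨d, s, b, u₁, hs, hb, hu⟩ | ⟨d, s, b, u₁, hs, hb, hu⟩ | ⟨q₁, q₂, h'⟩ <;>
  simp only [ang] at ha
  · obtain rfl : a = b := mul_left_cancel₀ hp.ne' ha
    simp only [path, circlePath_eq, mul_zero, zero_add, mul_one] at h0 h1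
    obtain ⟨rfl, rfl, rfl⟩ := circle_data_unique hr hs ht hu
      ⟨by nlinarith [ha'.1], by nlinarith [ha'.2]⟩ h0 h1
    rfl
  · nlinarith [ha'.1, hb.1]
  · nlinarith [ha'.1]
  · nlinarith [ha'.1, hb.1]
  · obtain rfl : a = b := mul_left_cancel₀ hp.ne' (neg_injective ha)
    simp only [path, circlePath_eq, mul_zero, zero_add, mul_one, sub_zero, sub_self] at h0 h1
    obtain ⟨rfl, rfl, rfl⟩ := circle_data_unique hr hs ht hu
      ⟨by nlinarith [ha'.1], by nlinarith [ha'.2]⟩ h1 h0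
    rfl
  · nlinarith [ha'.1]
  · nlinarith [hb.1]
  · nlinarith [hb.1]
  · simp [path] at h0 h1
    subst h0 h1
    rfl

/-- The radius vector at the start is the chord divided by `cis (2 * φ) - 1`. A negative angle is
obtained by reversing the arc from `y` to `x`. -/
lemma exists_arc {x y : ℂ} (h : x ≠ y) {φ : ℝ} (hφ : |φ| < Real.pi) :
    ∃ γ : Arc, γ 0 = x ∧ γ 1 = y ∧ γ.ang = φ := by
  have hp := Real.pi_pos
  have key : ∀ {x y : ℂ} {φ : ℝ}, x ≠ y → 0 < φ → φ < Real.pi →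
      ∃ (c : ℂ) (r : ℝ), 0 < r ∧ ∃ t ∈ Ico 0 (2 * Real.pi), c + r * cis t = x ∧
        c + r * cis (2 * φ + t) = y := by
    intro x y φ h h0 h1
    have hω1 : cis (2 * φ) - 1 ≠ 0 := by
      intro h
      have : 2 * φ = 0 := cis_injOn (by rw [sub_eq_zero.1 h, cis_zero])
        (by rw [sub_zero, abs_of_pos (by linarith)]; linarith)
      linarith
    obtain ⟨r, hr, t, ht, e⟩ := exists_polar (div_ne_zero (sub_ne_zero.2 h.symm) hω1)
    refine ⟨x - r * cis t, r, hr, t, ht, by ring, ?_⟩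
    rw [div_eq_iff hω1] at e
    rw [cis_add]
    linear_combination -e
  rw [abs_lt] at hφ
  rcases lt_trichotomy φ 0 with h0 | rfl | h0
  · obtain ⟨c, r, hr, t, ht, e0, e1⟩ := key h.symm (neg_pos.2 h0) (by linarith)
    have e : Real.pi * (-φ / Real.pi) = -φ := by field_simp
    refine ⟨neg c r (-φ / Real.pi) t hr ⟨div_pos (neg_pos.2 h0) hp, ?_⟩ ht, ?_, ?_, ?_⟩
    · rw [div_lt_one hp]; linarith
    · simp only [path, circlePath_eq, mul_assoc, e, sub_zero, mul_one, e1]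
    · simp only [path, circlePath_eq, sub_self, mul_zero, zero_add, e0]
    · simp [ang, e]
  · exact ⟨seg x y h, by simp [path], by simp [path], rfl⟩
  · obtain ⟨c, r, hr, t, ht, e0, e1⟩ := key h h0 hφ.2
    have e : Real.pi * (φ / Real.pi) = φ := by field_simp
    refine ⟨pos c r (φ / Real.pi) t hr ⟨div_pos h0 hp, ?_⟩ ht, ?_, ?_, ?_⟩
    · rw [div_lt_one hp]; linarith
    · simp only [path, circlePath_eq, mul_zero, zero_add, e0]
    · simp only [path, circlePath_eq, mul_assoc, e, mul_one, e1]
    · simp [ang, e]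

/-! ### Weights, and the side function along an arc. -/

/-- The weight of the endpoint `γ 1` in the rational parametrization of an arc. -/
noncomputable def wt (γ : Arc) (t : ℝ) : ℝ := sinRatio γ.ang t

@[simp] lemma wt_zero (γ : Arc) : γ.wt 0 = 0 := sinRatio_zero _

@[simp] lemma wt_one (γ : Arc) : γ.wt 1 = 1 := sinRatio_one γ.abs_ang_lt

lemma wt_pos (γ : Arc) {t : ℝ} (h0 : 0 < t) (h1 : t ≤ 1) : 0 < γ.wt t :=
  sinRatio_pos' γ.abs_ang_lt h0 h1

lemma wt_nonneg (γ : Arc) {t : ℝ} (h0 : 0 ≤ t) (h1 : t ≤ 1) : 0 ≤ γ.wt t :=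
  sinRatio_nonneg γ.abs_ang_lt h0 h1

lemma wt_cross (γ : Arc) (s t : ℝ) :
    γ.wt t * γ.wt (1 - s) - γ.wt s * γ.wt (1 - t) = γ.wt (t - s) :=
  sinRatio_cross γ.abs_ang_lt s t

lemma continuous_wt (γ : Arc) : Continuous γ.wt := continuous_sinRatio _

lemma wt_neg (γ : Arc) (t : ℝ) : γ.wt (-t) = -γ.wt t := sinRatio_neg _ _

lemma exists_wt_eq (γ : Arc) {l : ℝ} (hl : 0 ≤ l) :
    ∃ t ∈ Ico (0 : ℝ) 1, γ.wt t = l * γ.wt (1 - t) := exists_sinRatio_eq γ.abs_ang_lt hl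

/-- The ratio `wt t / wt (1 - t)` increases with `t`. -/
lemma wt_mul_lt (γ : Arc) {s t : ℝ} (h : s < t) (h1 : t - s ≤ 1) :
    γ.wt s * γ.wt (1 - t) < γ.wt t * γ.wt (1 - s) := by
  have := γ.wt_pos (sub_pos.2 h) h1
  linarith [γ.wt_cross s t]

lemma cis_wt (γ : Arc) (t : ℝ) :
    cis (γ.ang * t) * γ.wt (1 - t) + cis (γ.ang * (t - 1)) * γ.wt t = 1 :=
  cis_sinRatio γ.abs_ang_lt t

lemma path_sub_start (γ : Arc) (t : ℝ) :
    γ t - γ 0 = (γ 1 - γ 0) * (cis (γ.ang * (t - 1)) * γ.wt t) := by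
  have := γ.path_eq t
  change γ t = γ 0 * (cis (γ.ang * t) * γ.wt (1 - t)) + γ 1 * (cis (γ.ang * (t - 1)) * γ.wt t) at this
  linear_combination this + γ 0 * γ.cis_wt t

lemma path_sub_end (γ : Arc) (t : ℝ) :
    γ t - γ 1 = (γ 0 - γ 1) * (cis (γ.ang * t) * γ.wt (1 - t)) := by
  linear_combination γ.path_sub_start t + (γ 1 - γ 0) * γ.cis_wt t

lemma norm_sub_pos (γ : Arc) : 0 < ‖γ 1 - γ 0‖ :=
  norm_pos_iff.2 (sub_ne_zero.2 γ.start_ne_end.symm)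

/-- The distances to the two endpoints determine both weights, and the ratio of the weights is
strictly monotone. -/
lemma path_injOn (γ : Arc) {s t : ℝ} (hs : s ∈ Icc (0 : ℝ) 1) (ht : t ∈ Icc (0 : ℝ) 1)
    (h : γ s = γ t) : s = t := by
  have key : ∀ {u}, u ∈ Icc (0 : ℝ) 1 → ‖γ u - γ 0‖ = ‖γ 1 - γ 0‖ * γ.wt u ∧
      ‖γ u - γ 1‖ = ‖γ 0 - γ 1‖ * γ.wt (1 - u) := by
    intro u hu
    rw [path_sub_start, path_sub_end]
    simp only [norm_mul, norm_cis, one_mul, Complex.norm_real, Real.norm_eq_abs]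
    rw [abs_of_nonneg (γ.wt_nonneg hu.1 hu.2),
      abs_of_nonneg (γ.wt_nonneg (sub_nonneg.2 hu.2) (by linarith [hu.1]))]
    exact ⟨rfl, rfl⟩
  have hn := γ.norm_sub_pos
  have e0 : γ.wt s = γ.wt t := by
    apply mul_left_cancel₀ hn.ne'
    rw [← (key hs).1, ← (key ht).1, h]
  have e1 : γ.wt (1 - s) = γ.wt (1 - t) := by
    apply mul_left_cancel₀ hn.ne'
    rw [norm_sub_rev, ← (key hs).2, ← (key ht).2, h]
  rcases lt_trichotomy s t with h' | h' | h'
  · have := γ.wt_mul_lt h' (by linarith [ht.2, hs.1])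
    rw [e0, e1] at this
    exact absurd this (lt_irrefl _)
  · exact h'
  · have := γ.wt_mul_lt h' (by linarith [ht.1, hs.2])
    rw [e0, e1] at this
    exact absurd this (lt_irrefl _)

lemma continuous_path (γ : Arc) : Continuous γ.path :=
  continuous_iff_continuousAt.2 fun t => (γ.hasDerivAt_path t).continuousAt

lemma continuous_side (γ : Arc) : Continuous γ.side := by
  unfold side
  have := Complex.continuous_conj
  fun_prop

/-- The mixed coefficient of the quadratic form that describes `α.side` along `γ`. -/
noncomputable def bend (α γ : Arc) : ℂ :=
  cis (-α.ang) * (cis γ.ang * (α 1 - γ 0) * conj (α 0 - γ 1) +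
    cis (-γ.ang) * (α 1 - γ 1) * conj (α 0 - γ 0))

/-- Both factors of `side` are combinations of their values at the endpoints of `γ`, since the
Bézier coefficients add up to 1. On multiplying by the conjugate, the phases cancel in the square
terms and leave `cis (±γ.ang)`, independent of `t`, in the mixed ones. -/
lemma side_path (α γ : Arc) (t : ℝ) :
    α.side (γ t) = α.side (γ 0) * (γ.wt (1 - t) : ℂ) ^ 2 + α.bend γ * (γ.wt t * γ.wt (1 - t)) +
      α.side (γ 1) * (γ.wt t : ℂ) ^ 2 := by
  have hab := γ.cis_wt t
  have hab' := congrArg conj hab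
  simp only [map_add, map_mul, conj_cis, Complex.conj_ofReal, map_one] at hab'
  have hz := γ.path_sub_start t
  have hz' := congrArg conj hz
  simp only [map_sub, map_mul, conj_cis, Complex.conj_ofReal] at hz'
  have e1 := cis_mul_cis_neg (γ.ang * t)
  have e2 := cis_mul_cis_neg (γ.ang * (t - 1))
  have e3 : cis (γ.ang * t) * cis (-(γ.ang * (t - 1))) = cis γ.ang := by
    rw [← cis_add]; congr 1; ring
  have e4 : cis (γ.ang * (t - 1)) * cis (-(γ.ang * t)) = cis (-γ.ang) := by
    rw [← cis_add]; congr 1; ring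
  have h1 : α 1 - γ t = cis (γ.ang * t) * γ.wt (1 - t) * (α 1 - γ 0) +
      cis (γ.ang * (t - 1)) * γ.wt t * (α 1 - γ 1) := by
    linear_combination -hz - (α 1 - γ 0) * hab
  have h2 : conj (α 0 - γ t) = cis (-(γ.ang * t)) * γ.wt (1 - t) * conj (α 0 - γ 0) +
      cis (-(γ.ang * (t - 1))) * γ.wt t * conj (α 0 - γ 1) := by
    simp only [map_sub]
    linear_combination -hz' - (conj (α 0) - conj (γ 0)) * hab'
  simp only [side, bend, h1, h2]
  linear_combination cis (-α.ang) * (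
    e1 * (γ.wt (1 - t)) ^ 2 * (α 1 - γ 0) * conj (α 0 - γ 0) +
    e2 * (γ.wt t) ^ 2 * (α 1 - γ 1) * conj (α 0 - γ 1) +
    e3 * (γ.wt (1 - t) * γ.wt t) * (α 1 - γ 0) * conj (α 0 - γ 1) +
    e4 * (γ.wt (1 - t) * γ.wt t) * (α 1 - γ 1) * conj (α 0 - γ 0))

@[simp] lemma side_start (γ : Arc) : γ.side (γ 0) = 0 := by simp [side]

@[simp] lemma side_end (γ : Arc) : γ.side (γ 1) = 0 := by simp [side]

lemma side_self (γ : Arc) (t : ℝ) :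
    γ.side (γ t) = ((-(‖γ 1 - γ 0‖ ^ 2 * (γ.wt t * γ.wt (1 - t))) : ℝ) : ℂ) := by
  rw [side_path, side_start, side_end, bend]
  have := Complex.mul_conj' (γ 1 - γ 0)
  have e := cis_mul_cis_neg γ.ang
  simp only [map_sub, sub_self] at this ⊢
  push_cast
  linear_combination (-(γ.wt t * γ.wt (1 - t)) : ℂ) * this -
    ((γ 1 - γ 0) * (conj (γ 1) - conj (γ 0)) * (γ.wt t * γ.wt (1 - t))) * e

lemma side_im_of_mem_carrier {γ : Arc} {z : ℂ} (h : z ∈ γ.carrier) : (γ.side z).im = 0 := by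
  obtain ⟨t, rfl⟩ := h
  rw [side_self]
  exact Complex.ofReal_im _

/-- Inscribed angles: off the endpoints, the argument of `side` is the angle under which the chord
is seen, corrected by the opening angle. On the circle or line it is π on the arc and 0 on the
complementary part. -/
lemma mem_image_iff {γ : Arc} {z : ℂ} : z ∈ γ.image ↔ (γ.side z).im = 0 ∧ (γ.side z).re ≤ 0 := by
  constructor
  · rintro ⟨t, ht, rfl⟩
    rw [side_self]
    refine ⟨Complex.ofReal_im _, ?_⟩
    rw [Complex.ofReal_re, neg_nonpos]
    have := γ.wt_nonneg ht.1 ht.2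
    have := γ.wt_nonneg (sub_nonneg.2 ht.2) (by linarith [ht.1])
    positivity
  · rintro ⟨him, hre⟩
    rcases eq_or_ne z (γ 1) with rfl | hz
    · exact ⟨1, by simp, rfl⟩
    have hn : 0 < ‖γ 1 - z‖ := norm_pos_iff.2 (sub_ne_zero.2 hz.symm)
    set r := -(γ.side z).re with hr
    have hs : γ.side z = -(r : ℂ) := by
      apply Complex.ext <;> simp [hr, him]
    -- If `z = γ t`, then `r` is the squared chord times `wt t * wt (1 - t)` and the denominator is
    -- the squared chord times `wt (1 - t) ^ 2`, so this is the only possible weight ratio.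
    obtain ⟨t, ht, hw⟩ := γ.exists_wt_eq (l := r / ‖γ 1 - z‖ ^ 2)
      (div_nonneg (by linarith) (by positivity))
    refine ⟨t, ⟨ht.1, ht.2.le⟩, ?_⟩
    have hw' : (γ.wt t : ℂ) * ‖γ 1 - z‖ ^ 2 = r * γ.wt (1 - t) := by
      have : γ.wt t * ‖γ 1 - z‖ ^ 2 = r * γ.wt (1 - t) := by
        rw [hw]; field_simp
      exact_mod_cast this
    have hs' := congrArg conj hs
    simp only [side, map_mul, conj_cis, neg_neg, Complex.conj_conj, map_neg,
      Complex.conj_ofReal] at hs'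
    have hm := Complex.mul_conj' (γ 1 - z)
    have e := cis_mul_cis_neg γ.ang
    have e4 : cis (γ.ang * (t - 1)) = cis (-γ.ang) * cis (γ.ang * t) := by
      rw [← cis_add]; congr 1; ring
    have hab := γ.cis_wt t
    have hz := γ.path_sub_start t
    have key : (‖γ 1 - z‖ : ℂ) ^ 2 * (γ t - z) = 0 := by
      rw [e4] at hz hab
      linear_combination (‖γ 1 - z‖ : ℂ) ^ 2 * hz +
        (‖γ 1 - z‖ : ℂ) ^ 2 * (z - γ 0) * hab +
        (γ 1 - z) * cis (-γ.ang) * cis (γ.ang * t) * hw' +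
        cis (γ.ang * t) * γ.wt (1 - t) * (cis (-γ.ang) * (γ 1 - z) * hs'
         - (γ 0 - z) * hm - (γ 0 - z) * (γ 1 - z) * conj (γ 1 - z) * e)
    have hn' : (‖γ 1 - z‖ : ℂ) ^ 2 ≠ 0 := by exact_mod_cast (pow_pos hn 2).ne'
    exact sub_eq_zero.1 ((mul_eq_zero.1 key).resolve_left hn')

/-! ### Tangent directions. -/

/-- A positive multiple of the tangent vector: the chord, turned. -/
noncomputable def chordDir (γ : Arc) (t : ℝ) : ℂ := (γ 1 - γ 0) * cis (γ.ang * (2 * t - 1))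

lemma tangent_eq_chordDir (γ : Arc) (t : ℝ) :
    γ.tangent t = ((‖γ 1 - γ 0‖⁻¹ : ℝ) : ℂ) * γ.chordDir t := by
  rw [tangent_eq, Complex.real_smul, chordDir]

lemma chordDir_eq_of_tangent_eq_mul {γ δ : Arc} {s t : ℝ} {c : ℂ}
    (h : γ.tangent s = c * δ.tangent t) :
    ∃ k : ℝ, 0 < k ∧ γ.chordDir s = k * (c * δ.chordDir t) := by
  have hγ := γ.norm_sub_pos
  refine ⟨‖γ 1 - γ 0‖ * ‖δ 1 - δ 0‖⁻¹, by have := δ.norm_sub_pos; positivity, ?_⟩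
  have hc : (‖γ 1 - γ 0‖ : ℂ) ≠ 0 := by exact_mod_cast hγ.ne'
  rw [tangent_eq_chordDir, tangent_eq_chordDir] at h
  push_cast at h ⊢
  rw [inv_mul_eq_iff_eq_mul₀ hc] at h
  rw [h]
  ring

lemma chordDir_eq_of_tangent_eq {γ δ : Arc} {s t : ℝ} (h : γ.tangent s = δ.tangent t) :
    ∃ k : ℝ, 0 < k ∧ γ.chordDir s = k * δ.chordDir t := by
  simpa using chordDir_eq_of_tangent_eq_mul (c := 1) (by simpa using h)

/-- An arc is determined by its endpoints and its initial tangent. -/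
lemma IsArcWithTangent.unique {τ x y : ℂ} {γ δ : Arc} (hγ : IsArcWithTangent τ x y γ)
    (hδ : IsArcWithTangent τ x y δ) : γ = δ := by
  obtain ⟨h0, h1, ht⟩ := hγ
  obtain ⟨h0', h1', ht'⟩ := hδ
  refine ext_ang (h0.trans h0'.symm) (h1.trans h1'.symm) ?_
  have h := ht.trans ht'.symm
  rw [tangent_eq_chordDir, tangent_eq_chordDir, chordDir, chordDir, h0, h1, h0', h1'] at h
  have hxy : x ≠ y := h0 ▸ h1 ▸ γ.start_ne_end
  have hn : ((‖y - x‖⁻¹ : ℝ) : ℂ) ≠ 0 := by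
    simpa [sub_eq_zero] using hxy.symm
  have h2 := mul_left_cancel₀ (sub_ne_zero.2 hxy.symm) (mul_left_cancel₀ hn h)
  have hb := abs_lt.1 γ.abs_ang_lt
  have hb' := abs_lt.1 δ.abs_ang_lt
  have := cis_injOn h2 (by rw [abs_lt]; constructor <;> linarith [hb.1, hb.2, hb'.1, hb'.2])
  linarith

lemma abs_arg_lt_pi {w : ℂ} (h : w ∈ Complex.slitPlane) : |w.arg| < Real.pi :=
  abs_lt.2 ⟨Complex.neg_pi_lt_arg w,
    lt_of_le_of_ne (Complex.arg_le_pi w) (Complex.mem_slitPlane_iff_arg.1 h).1⟩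

lemma cis_arg {w : ℂ} (h : w ≠ 0) : cis w.arg = w / ‖w‖ := by
  have : (‖w‖ : ℂ) ≠ 0 := by simpa using h
  rw [eq_div_iff this, mul_comm, norm_mul_cis_arg]

/-- The arc from `x` to `y` with opening angle given by the initial direction `v`. -/
lemma exists_arc_of_dir {x y v : ℂ} (h : x ≠ y) (hv : v / (y - x) ∈ Complex.slitPlane) :
    ∃ γ : Arc, γ 0 = x ∧ γ 1 = y ∧ γ.ang = -(v / (y - x)).arg ∧
      ∃ k : ℝ, 0 < k ∧ γ.chordDir 0 = k * v := by
  obtain ⟨γ, h0, h1, ha⟩ := exists_arc h (φ := -(v / (y - x)).arg)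
    (by rw [abs_neg]; exact abs_arg_lt_pi hv)
  have hw := Complex.slitPlane_ne_zero hv
  refine ⟨γ, h0, h1, ha, ‖v / (y - x)‖⁻¹, inv_pos.2 (norm_pos_iff.2 hw), ?_⟩
  have hyx : y - x ≠ 0 := sub_ne_zero.2 h.symm
  have e : -(v / (y - x)).arg * (2 * 0 - 1) = (v / (y - x)).arg := by ring
  rw [chordDir, h0, h1, ha, e, cis_arg hw]
  push_cast
  field_simp

lemma tangent_of_chordDir {γ : Arc} {t k : ℝ} {v : ℂ} (hk : 0 < k) (hv : ‖v‖ = 1)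
    (h : γ.chordDir t = k * v) : γ.tangent t = v := by
  have hn : ‖γ 1 - γ 0‖ = k := by
    have := congrArg norm h
    rwa [chordDir, norm_mul, norm_cis, norm_mul, hv, mul_one, mul_one, Complex.norm_real,
      Real.norm_eq_abs, abs_of_pos hk] at this
  have : (k : ℂ) ≠ 0 := by exact_mod_cast hk.ne'
  rw [tangent_eq_chordDir, h, hn]
  push_cast
  field_simp

/-- At a common point `γ 0 = σ s`, the mixed coefficient of `σ.side` along `γ` compares tangents. -/
lemma bend_im_eq_cross {σ γ : Arc} {s : ℝ} (h : γ 0 = σ s) :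
    (σ.bend γ).im = (γ.chordDir 0 * conj (σ.chordDir s)).im := by
  have hN : (σ.side (γ 0)).im = 0 := side_im_of_mem_carrier ⟨s, h.symm⟩
  have hG : γ.chordDir 0 = (γ 1 - γ 0) * cis (-γ.ang) := by
    rw [chordDir]; congr 2; ring
  have e : cis σ.ang * (σ 0 - γ 0) - cis (-σ.ang) * (σ 1 - γ 0) = -σ.chordDir s := by
    have h1 := σ.path_sub_start s
    have h2 := σ.path_sub_end s
    have h3 := congrArg conj (σ.cis_wt s)
    simp only [map_add, map_mul, conj_cis, Complex.conj_ofReal, map_one] at h3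
    have e1 : cis σ.ang * cis (σ.ang * (s - 1)) =
        cis (σ.ang * (2 * s - 1)) * cis (-(σ.ang * (s - 1))) := by
      simp only [← cis_add]; congr 1; ring
    have e2 : cis (-σ.ang) * cis (σ.ang * s) = cis (σ.ang * (2 * s - 1)) * cis (-(σ.ang * s)) := by
      simp only [← cis_add]; congr 1; ring
    rw [h, chordDir]
    linear_combination -cis σ.ang * h1 + cis (-σ.ang) * h2 - (σ 1 - σ 0) * σ.wt s * e1 -
      (σ 1 - σ 0) * σ.wt (1 - s) * e2 - (σ 1 - σ 0) * cis (σ.ang * (2 * s - 1)) * h3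
  have hb : σ.bend γ = (2 * Real.cos γ.ang : ℝ) * σ.side (γ 0) -
      (cis (-σ.ang) * (σ 1 - γ 0) * conj (γ.chordDir 0) +
        cis (-σ.ang) * γ.chordDir 0 * conj (σ 0 - γ 0)) := by
    have hc : ((2 * Real.cos γ.ang : ℝ) : ℂ) = cis γ.ang + cis (-γ.ang) := by
      simp only [cis_eq]; simp; ring
    rw [hc, hG, bend, side]
    simp only [map_mul, map_sub, conj_cis, neg_neg]
    ring
  have hJ : (cis (-σ.ang) * γ.chordDir 0 * conj (σ 0 - γ 0)).im =
      -(cis σ.ang * conj (γ.chordDir 0) * (σ 0 - γ 0)).im := by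
    rw [← Complex.conj_im]
    simp only [map_mul, conj_cis, Complex.conj_conj]
  rw [hb, Complex.sub_im, Complex.im_ofReal_mul, hN, Complex.add_im, hJ, mul_zero, zero_sub,
    ← sub_eq_add_neg, neg_sub, ← Complex.sub_im]
  have : cis σ.ang * conj (γ.chordDir 0) * (σ 0 - γ 0) -
      cis (-σ.ang) * (σ 1 - γ 0) * conj (γ.chordDir 0) =
      -conj (γ.chordDir 0 * conj (σ.chordDir s)) := by
    simp only [map_mul, Complex.conj_conj]
    linear_combination conj (γ.chordDir 0) * e
  rw [this, Complex.neg_im, Complex.conj_im, neg_neg]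

/-! ### Arcs with a common endpoint: excluding cuts from the left. -/

/-- The side of `α` along an arc that ends on the circle or line of `α`. -/
lemma side_path_im_of_end {α γ : Arc} (h : (α.side (γ 1)).im = 0) (t : ℝ) :
    (α.side (γ t)).im =
      γ.wt (1 - t) * ((α.side (γ 0)).im * γ.wt (1 - t) + (α.bend γ).im * γ.wt t) := by
  rw [side_path]
  simp only [Complex.add_im, ← Complex.ofReal_pow, ← Complex.ofReal_mul, Complex.im_mul_ofReal, h]
  ring

/-- The side of `α` along an arc that starts on the circle or line of `α`. -/
lemma side_path_im_of_start {α γ : Arc} (h : (α.side (γ 0)).im = 0) (t : ℝ) :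
    (α.side (γ t)).im =
      γ.wt t * ((α.bend γ).im * γ.wt (1 - t) + (α.side (γ 1)).im * γ.wt t) := by
  rw [side_path]
  simp only [Complex.add_im, ← Complex.ofReal_pow, ← Complex.ofReal_mul, Complex.im_mul_ofReal, h]
  ring

lemma inner_subset_image (γ : Arc) : γ.inner ⊆ γ.image := image_mono Ioo_subset_Icc_self

lemma image_subset_carrier (γ : Arc) : γ.image ⊆ γ.carrier := image_subset_range _ _

lemma start_mem_image (γ : Arc) : γ 0 ∈ γ.image := ⟨0, by simp, rfl⟩

lemma end_mem_image (γ : Arc) : γ 1 ∈ γ.image := ⟨1, by simp, rfl⟩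

lemma end_notMem_inner (γ : Arc) : γ 1 ∉ γ.inner := by
  rintro ⟨t, ht, h⟩
  exact ht.2.ne (γ.path_injOn ⟨ht.1.le, ht.2.le⟩ (by simp) h)

/-- Along `α`, the side of `γ` is a positive weight times a linear form with nonpositive constant
term. A zero forces a nonnegative slope, so the form is nonpositive just before it. -/
lemma not_approachesLeft {α γ : Arc} (h1 : α 1 = γ 1) (h0 : (γ.side (α 0)).im ≤ 0) (t : ℝ) :
    ¬ α.ApproachesLeft γ t := by
  rintro ⟨ht, hin, hev⟩
  have hend : (γ.side (α 1)).im = 0 := by simp [h1]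
  have ht1 : t < 1 := by
    refine lt_of_le_of_ne ht.2 ?_
    rintro rfl
    exact γ.end_notMem_inner (h1 ▸ hin)
  have hz : (γ.side (α t)).im = 0 :=
    side_im_of_mem_carrier (γ.image_subset_carrier (γ.inner_subset_image hin))
  obtain ⟨ε, hl, hε⟩ := (hev.and (Ioo_mem_nhdsGT ht.1)).exists
  rw [strictlyLeft_iff, side_path_im_of_end hend] at hl
  rw [side_path_im_of_end hend] at hz
  have a' := α.wt_pos (sub_pos.2 ht1) (by linarith [ht.1])
  have b' := α.wt_pos ht.1 ht.2
  have a := α.wt_pos (t := 1 - (t - ε)) (by linarith [hε.1]) (by linarith [hε.2])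
  have hc := α.wt_mul_lt (s := t - ε) (t := t) (by linarith [hε.1]) (by linarith [hε.2, ht.2])
  have hz' := (mul_eq_zero.1 hz).resolve_left a'.ne'
  have hl' := (mul_pos_iff_of_pos_left a).1 hl
  have hβ : 0 ≤ (γ.bend α).im := by
    by_contra! hneg
    nlinarith [mul_nonneg (neg_nonneg.2 h0) a'.le, mul_pos (neg_pos.2 hneg) b']
  nlinarith [mul_pos hl' a', mul_nonneg hβ (sub_nonneg.2 hc.le)]

/-- Tangency at the common end makes the mixed coefficient real, so `γ` stays on one side of `α`,
here the right. The same tangency makes `γ.side (α 0)` a negative multiple of `α.side (γ 0)`. -/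
lemma side_start_pos_of_tangent_end_eq {α γ : Arc} (h1 : α 1 = γ 1)
    (ht : α.tangent 1 = γ.tangent 1)
    (hev : ∀ᶠ ε in 𝓝[>] (0 : ℝ), StrictlyRight (γ (1 - ε)) α) : 0 < (γ.side (α 0)).im := by
  obtain ⟨k, hk, hd⟩ := chordDir_eq_of_tangent_eq ht
  simp only [chordDir] at hd
  have hd' : (α 1 - α 0) * cis α.ang = k * ((γ 1 - γ 0) * cis γ.ang) := by
    convert hd using 2
    · congr 1; ring
    · congr 2; ring
  have hdc := congrArg conj hd'
  simp only [map_mul, conj_cis, Complex.conj_ofReal, map_sub] at hdc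
  have hend : (α.side (γ 1)).im = 0 := by simp [← h1]
  have hb : (α.bend γ).im = 0 := by
    have : α.bend γ = ((-(k * ‖γ 1 - γ 0‖ ^ 2) : ℝ) : ℂ) := by
      have := Complex.mul_conj' (γ 1 - γ 0)
      have e := cis_mul_cis_neg γ.ang
      simp only [map_sub] at this
      push_cast
      rw [bend, h1, ← this, map_sub, map_sub, ← h1]
      rw [h1] at hdc ⊢
      linear_combination -hdc * cis γ.ang * (γ 1 - γ 0) -
        k * (conj (γ 1) - conj (γ 0)) * (γ 1 - γ 0) * e
    rw [this, Complex.ofReal_im]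
  obtain ⟨ε, hr, hε⟩ := (hev.and (Ioo_mem_nhdsGT zero_lt_one)).exists
  rw [strictlyRight_iff, side_path_im_of_end hend, hb] at hr
  have a := γ.wt_pos (t := 1 - (1 - ε)) (by linarith [hε.1]) (by linarith [hε.2])
  have hneg : (α.side (γ 0)).im < 0 := by
    by_contra! hpos
    nlinarith [mul_nonneg hpos (mul_pos a a).le]
  have key : ((k * ‖γ 1 - γ 0‖ ^ 2 : ℝ) : ℂ) * γ.side (α 0) =
      ((-‖α 1 - α 0‖ ^ 2 : ℝ) : ℂ) * α.side (γ 0) := by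
    have e1 := Complex.mul_conj' (γ 1 - γ 0)
    have e2 := Complex.mul_conj' (α 1 - α 0)
    simp only [side]
    push_cast
    rw [← e1, ← e2]
    simp only [map_sub] at hdc ⊢
    rw [h1] at hdc ⊢
    linear_combination -((γ 1 - α 0) * (γ 1 - γ 0) * (conj (γ 0) - conj (α 0))) * hdc
  have hk2 := congrArg Complex.im key
  rw [Complex.im_ofReal_mul, Complex.im_ofReal_mul] at hk2
  have hn1 := pow_pos γ.norm_sub_pos 2
  have hn2 := pow_pos α.norm_sub_pos 2
  have : 0 < k * ‖γ 1 - γ 0‖ ^ 2 * (γ.side (α 0)).im := by rw [hk2]; nlinarith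
  exact (mul_pos_iff_of_pos_left (by positivity)).1 this

/-- An arc that does not start strictly to the left of another one with the same endpoint does not
cut it from the left. -/
lemma extCutsFromLeft_eq_empty {α γ : Arc} (h1 : α 1 = γ 1) (h0 : (γ.side (α 0)).im ≤ 0)
    (hα : α 0 ∉ γ.image) (hγ : γ 0 ∉ α.image) : α.extCutsFromLeft γ = ∅ := by
  rw [eq_empty_iff_forall_notMem]
  rintro t (⟨h, -⟩ | ⟨-, h, -⟩ | ⟨-, -, ⟨-, t', -, -, h, -⟩ | ⟨-, h, hev⟩⟩)
  · exact hα h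
  · exact hγ h
  · exact not_approachesLeft h1 h0 t' h
  · exact absurd (side_start_pos_of_tangent_end_eq h1 h hev) (not_lt.2 h0)

/-! ### Passing to the closure of a set of arcs. -/

lemma isClosed_image (γ : Arc) : IsClosed γ.image :=
  (isCompact_Icc.image γ.continuous_path).isClosed

/-- Closed conditions on the endpoints and one further point pass to the closure. -/
lemma mem_of_mem_arcClosure {S : Set Arc} {γ : Arc} (hγ : γ ∈ arcClosure S) {C : Set (ℂ × ℂ × ℂ)}
    (hC : IsClosed C) {t : ℝ} (ht : t ∈ Icc (0 : ℝ) 1) (h : ∀ δ ∈ S, (δ 0, δ t, δ 1) ∈ C) :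
    (γ 0, γ t, γ 1) ∈ C := by
  rw [← hC.closure_eq, Metric.mem_closure_iff]
  intro ε hε
  obtain ⟨δ, hδ, hd⟩ := hγ ε hε
  refine ⟨_, h δ hδ, ?_⟩
  rw [Prod.dist_eq, Prod.dist_eq]
  simp only [dist_eq_norm, sup_lt_iff]
  exact ⟨hd 0 (by simp), hd t ht, hd 1 (by simp)⟩

/-- The left side is continuous in the three points `γ 0`, `γ t`, `γ 1`. This turns the sign of the
mixed coefficient into a closed condition on them. -/
lemma bend_im_mul_eq {α γ : Arc} (h : (α.side (γ 0)).im = 0) (t : ℝ) :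
    ‖γ 1 - γ 0‖ ^ 2 * (α.side (γ t)).im - (α.side (γ 1)).im * ‖γ t - γ 0‖ ^ 2 =
      ‖γ 1 - γ 0‖ ^ 2 * ((α.bend γ).im * (γ.wt t * γ.wt (1 - t))) := by
  rw [path_sub_start γ t, side_path_im_of_start h, norm_mul, norm_mul, norm_cis, Complex.norm_real,
    Real.norm_eq_abs, one_mul, mul_pow, sq_abs]
  ring

lemma side_im_of_mem_image {γ : Arc} {z : ℂ} (h : z ∈ γ.image) : (γ.side z).im = 0 :=
  (mem_image_iff.1 h).1

/-- Divide the side of `σ` along `γ` by the positive weight `wt t` and let `t` tend to 0. -/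
lemma bend_im_nonneg_of_mem_star {σ γ : Arc} {p : ℂ} (h : γ ∈ σ.connectingStar p) :
    0 ≤ (σ.bend γ).im := by
  obtain ⟨hin, -, -, -, -, hev⟩ := h
  have h0 := side_im_of_mem_image (σ.inner_subset_image hin)
  have hc : Tendsto (fun t => (σ.bend γ).im * γ.wt (1 - t) + (σ.side (γ 1)).im * γ.wt t)
      (𝓝[>] 0) (𝓝 ((σ.bend γ).im)) := by
    have : Continuous (fun t => (σ.bend γ).im * γ.wt (1 - t) + (σ.side (γ 1)).im * γ.wt t) := by
      have := γ.continuous_wt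
      fun_prop
    simpa using (this.tendsto 0).mono_left nhdsWithin_le_nhds
  refine ge_of_tendsto hc ?_
  filter_upwards [hev, Ioo_mem_nhdsGT zero_lt_one] with ε hε hε1
  rw [strictlyLeft_iff, zero_add, side_path_im_of_start h0] at hε
  exact ((mul_pos_iff_of_pos_left (γ.wt_pos hε1.1 hε1.2.le)).1 hε).le

lemma mem_arcClosure_star {σ γ : Arc} {p : ℂ} (h : γ ∈ arcClosure (σ.connectingStar p)) :
    γ 0 ∈ σ.image ∧ γ 1 = p ∧ 0 ≤ (σ.bend γ).im := by
  have h0 : γ 0 ∈ σ.image :=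
    mem_of_mem_arcClosure h (σ.isClosed_image.preimage continuous_fst) (t := 0) (by simp)
      fun δ hδ => σ.inner_subset_image hδ.1
  have h1 : γ 1 = p :=
    mem_of_mem_arcClosure h (isClosed_singleton.preimage (continuous_snd.comp continuous_snd))
      (t := 0) (C := (fun z => z.2.2) ⁻¹' {p}) (by simp) fun δ hδ => hδ.2.2.1
  have hC : IsClosed {z : ℂ × ℂ × ℂ | 0 ≤ ‖z.2.2 - z.1‖ ^ 2 * (σ.side z.2.1).im -
      (σ.side z.2.2).im * ‖z.2.1 - z.1‖ ^ 2} := by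
    have := σ.continuous_side
    exact isClosed_le continuous_const (by fun_prop)
  have ht : (1 / 2 : ℝ) ∈ Icc (0 : ℝ) 1 := by norm_num
  have h2 := mem_of_mem_arcClosure h hC ht fun δ hδ => by
    have a := δ.wt_nonneg ht.1 ht.2
    have b := δ.wt_nonneg (t := 1 - 1 / 2) (by norm_num) (by norm_num)
    have := bend_im_nonneg_of_mem_star hδ
    rw [mem_ofPred_eq, bend_im_mul_eq (side_im_of_mem_image (σ.inner_subset_image hδ.1))]
    positivity
  rw [mem_ofPred_eq, bend_im_mul_eq (side_im_of_mem_image h0)] at h2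
  have a := γ.wt_pos (t := 1 / 2) (by norm_num) (by norm_num)
  have b := γ.wt_pos (t := 1 - 1 / 2) (by norm_num) (by norm_num)
  have c := pow_pos γ.norm_sub_pos 2
  refine ⟨h0, h1, ?_⟩
  exact nonneg_of_mul_nonneg_left (nonneg_of_mul_nonneg_right h2 c) (mul_pos a b)

/-- An arc is a limit of arcs with the same endpoint whose starting points and opening angles
converge. -/
lemma mem_arcClosure_of_continuousAt {S : Set Arc} {γ : Arc} {x : ℝ → ℂ} {φ : ℝ → ℝ}
    (hx : ContinuousAt x 0) (hφ : ContinuousAt φ 0) (hx0 : x 0 = γ 0) (hφ0 : φ 0 = γ.ang)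
    (h : ∀ᶠ s in 𝓝[>] (0 : ℝ), ∃ δ ∈ S, δ 0 = x s ∧ δ 1 = γ 1 ∧ δ.ang = φ s) :
    γ ∈ arcClosure S := by
  intro ε hε
  -- This is the Bézier form of `path_eq` with varying start and angle. Since `sinRatio` is written
  -- with `sinc`, it stays continuous at angle 0, where circular arcs degenerate to segments.
  let F : ℝ → ℝ → ℂ := fun s t => x s * (cis (φ s * t) * sinRatio (φ s) (1 - t)) +
      γ 1 * (cis (φ s * (t - 1)) * sinRatio (φ s) t)
  have hF : ∀ t, ContinuousAt (fun q : ℝ × ℝ => F q.1 q.2) (0, t) := by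
    intro t
    have h1 : ContinuousAt (fun q : ℝ × ℝ => x q.1) (0, t) :=
      ContinuousAt.comp (f := Prod.fst) (g := x) hx continuousAt_fst
    have h2 : ContinuousAt (fun q : ℝ × ℝ => φ q.1) (0, t) :=
      ContinuousAt.comp (f := Prod.fst) (g := φ) hφ continuousAt_fst
    have h3 : ∀ {f : ℝ × ℝ → ℝ}, ContinuousAt f (0, t) →
        ContinuousAt (fun q => (sinRatio (φ q.1) (f q) : ℂ)) (0, t) := by
      intro f hf
      refine Complex.continuous_ofReal.continuousAt.comp ?_
      refine ContinuousAt.div (hf.mul (Real.continuous_sinc.continuousAt.comp (h2.mul hf)))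
        (Real.continuous_sinc.continuousAt.comp h2) ?_
      simp only [hφ0]
      exact (sinc_pos γ.abs_ang_lt).ne'
    have h4 : ∀ {f : ℝ × ℝ → ℝ}, ContinuousAt f (0, t) →
        ContinuousAt (fun q => cis (φ q.1 * f q)) (0, t) := fun hf =>
      continuous_cis.continuousAt.comp (h2.mul hf)
    exact (h1.mul ((h4 continuousAt_snd).mul (h3 (continuousAt_const.sub continuousAt_snd)))).add
      (continuousAt_const.mul ((h4 (continuousAt_snd.sub continuousAt_const)).mul
        (h3 continuousAt_snd)))
  have hev : ∀ᶠ s in 𝓝 (0 : ℝ), ∀ t ∈ Icc (0 : ℝ) 1, ‖F 0 t - F s t‖ < ε := by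
    refine isCompact_Icc.eventually_forall_of_forall_eventually fun t _ => ?_
    have h0 : ContinuousAt (fun q : ℝ × ℝ => F 0 q.2) (0, t) :=
      ContinuousAt.comp (f := fun q : ℝ × ℝ => ((0 : ℝ), q.2)) (g := fun q : ℝ × ℝ => F q.1 q.2)
        (hF t) (by fun_prop)
    have := (h0.sub (hF t)).norm
    refine this.eventually_lt continuousAt_const ?_
    simpa using hε
  obtain ⟨s, hs, δ, hδ, h0, h1, ha⟩ := ((hev.filter_mono nhdsWithin_le_nhds).and h).exists
  refine ⟨δ, hδ, fun t ht => ?_⟩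
  rw [γ.path_eq, δ.path_eq, h0, h1, ha, ← hx0, ← hφ0]
  exact hs t ht

lemma mem_connectingStar {σ δ : Arc} {p : ℂ} {s : ℝ} (hs : s ∈ Ioo (0 : ℝ) 1) (h0 : δ 0 = σ s)
    (h1 : δ 1 = p) (hi : ∀ t ∈ Ioc (0 : ℝ) 1, δ t ∉ σ.image)
    (hl : ∀ᶠ ε in 𝓝[>] (0 : ℝ), 0 < (σ.side (δ ε)).im) : δ ∈ σ.connectingStar p := by
  have hin : δ 0 ∈ σ.inner := h0 ▸ ⟨s, hs, rfl⟩
  refine ⟨hin, ?_, h1, by simp, hin, ?_⟩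
  · apply Subset.antisymm
    · rintro _ ⟨⟨t, ht, rfl⟩, hz⟩
      rcases ht.1.eq_or_lt with rfl | h
      · rfl
      · exact absurd hz (hi t ⟨h, ht.2⟩)
    · rintro _ rfl
      exact ⟨δ.start_mem_image, σ.inner_subset_image hin⟩
  · simpa only [strictlyLeft_iff, zero_add] using hl

/-! ### The tangential arc at the end of the starting arc. -/

lemma arg_mul_cis {k θ : ℝ} (hk : 0 < k) (hθ : |θ| < Real.pi) :
    (k * cis θ).arg = θ ∧ (k * cis θ : ℂ) ∈ Complex.slitPlane := by
  have h := abs_lt.1 hθ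
  have e : (k * cis θ : ℂ).arg = θ := by
    rw [cis_eq]
    push_cast
    exact Complex.arg_mul_cos_add_sin_mul_I hk ⟨h.1, h.2.le⟩
  refine ⟨e, Complex.mem_slitPlane_iff_arg.2 ⟨by rw [e]; exact h.2.ne, ?_⟩⟩
  exact mul_ne_zero (by exact_mod_cast hk.ne') (cis_ne_zero _)

/-- If `γ` starts in direction `v`, its opening angle is the angle from `v` to the chord. -/
lemma ang_eq_of_chordDir {γ : Arc} {k : ℝ} {v : ℂ} (hk : 0 < k) (h : γ.chordDir 0 = k * v) :
    γ.ang = -(v / (γ 1 - γ 0)).arg ∧ v / (γ 1 - γ 0) ∈ Complex.slitPlane := by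
  have hn : γ 1 - γ 0 ≠ 0 := sub_ne_zero.2 γ.start_ne_end.symm
  have hk' : (k : ℂ) ≠ 0 := by exact_mod_cast hk.ne'
  have e : v / (γ 1 - γ 0) = (k⁻¹ : ℝ) * cis (-γ.ang) := by
    rw [div_eq_iff hn]
    have : γ.chordDir 0 = (γ 1 - γ 0) * cis (-γ.ang) := by rw [chordDir]; congr 2; ring
    rw [this] at h
    push_cast
    rw [eq_comm, mul_assoc, inv_mul_eq_iff_eq_mul₀ hk']
    linear_combination h
  have := arg_mul_cis (inv_pos.2 hk) (θ := -γ.ang) (by rw [abs_neg]; exact γ.abs_ang_lt)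
  rw [e]
  exact ⟨by rw [this.1, neg_neg], this.2⟩

lemma continuous_chordDir (γ : Arc) : Continuous γ.chordDir := by
  unfold chordDir
  have := continuous_cis
  fun_prop

lemma chordDir_ne_zero (γ : Arc) (t : ℝ) : γ.chordDir t ≠ 0 :=
  mul_ne_zero (sub_ne_zero.2 γ.start_ne_end.symm) (cis_ne_zero _)

/-- The tangential arc at the end of `σ` is a limit of tangential arcs at inner points. -/
lemma tangential_mem_arcClosure {σ γ : Arc} {p : ℂ} (hp : 0 < (σ.side p).im)
    (hγ : IsArcWithTangent (σ.tangent 1) (σ 1) p γ) : γ ∈ arcClosure (σ.connectingStar p) := by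
  obtain ⟨h0, h1, ht⟩ := hγ
  obtain ⟨k, hk, hd⟩ := chordDir_eq_of_tangent_eq ht
  obtain ⟨ha, hslit⟩ := ang_eq_of_chordDir hk hd
  rw [h0, h1] at ha hslit
  have hσp : σ 1 ≠ p := h0 ▸ h1 ▸ γ.start_ne_end
  have hcp := σ.continuous_path
  have hcd := σ.continuous_chordDir
  have hw : ContinuousAt (fun s : ℝ => σ.chordDir (1 - s) / (p - σ (1 - s))) 0 := by
    refine ContinuousAt.div (by fun_prop) (by fun_prop) ?_
    simpa [sub_eq_zero] using hσp.symm
  -- The approximating arcs leave `σ` tangentially at `σ (1 - s)`. Their mixed coefficient is real,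
  -- so the side of `σ` along them is that of `p` times a square.
  refine mem_arcClosure_of_continuousAt (x := fun s => σ (1 - s))
    (φ := fun s => -(σ.chordDir (1 - s) / (p - σ (1 - s))).arg) (by fun_prop) ?_
    (by simpa using h0.symm) (by simpa using ha.symm) ?_
  · exact (ContinuousAt.comp (g := Complex.arg)
      (Complex.continuousAt_arg (by simpa using hslit)) hw).neg
  · have e1 : ∀ᶠ s in 𝓝[>] (0 : ℝ),
        σ.chordDir (1 - s) / (p - σ (1 - s)) ∈ Complex.slitPlane :=
      (hw.eventually_mem (Complex.isOpen_slitPlane.mem_nhds (by simpa using hslit))).filter_mono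
        nhdsWithin_le_nhds
    filter_upwards [e1, Ioo_mem_nhdsGT zero_lt_one] with s hs hs1
    have hne : σ (1 - s) ≠ p := by
      intro h
      have := side_im_of_mem_carrier (γ := σ) ⟨1 - s, h⟩
      exact hp.ne' this
    obtain ⟨δ, d0, d1, da, l, hl, dd⟩ := exists_arc_of_dir hne hs
    have hb : (σ.bend δ).im = 0 := by
      rw [bend_im_eq_cross d0, dd, mul_assoc, Complex.mul_conj, ← Complex.ofReal_mul,
        Complex.ofReal_im]
    have hside : ∀ t, (σ.side (δ t)).im = (σ.side p).im * δ.wt t ^ 2 := by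
      intro t
      rw [side_path_im_of_start (d0 ▸ side_im_of_mem_carrier ⟨_, rfl⟩), hb, d1]
      ring
    have hpos : ∀ t ∈ Ioc (0 : ℝ) 1, 0 < (σ.side (δ t)).im := fun t ht => by
      have := δ.wt_pos ht.1 ht.2
      rw [hside]; positivity
    refine ⟨δ, mem_connectingStar (s := 1 - s) ⟨by linarith [hs1.2], by linarith [hs1.1]⟩ d0 d1 ?_ ?_,
      d0, by rw [d1, h1], da⟩
    · exact fun t ht h => (hpos t ht).ne' (side_im_of_mem_image h)
    · filter_upwards [Ioo_mem_nhdsGT zero_lt_one] with t ht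
      exact hpos t ⟨ht.1, ht.2.le⟩

lemma chordDir_zero (γ : Arc) : γ.chordDir 0 = (γ 1 - γ 0) * cis (-γ.ang) := by
  rw [chordDir]; congr 2; ring

lemma chordDir_one (γ : Arc) : γ.chordDir 1 = (γ 1 - γ 0) * cis γ.ang := by
  rw [chordDir]; congr 2; ring

/-- The opening angle is minus the argument of the tangent relative to the chord. Only the argument
π is not allowed, and it occurs exactly when the tangent points straight away from `p`. -/
lemma exists_isArcWithTangent {σ : Arc} {p : ℂ} (hp : p ∉ σ.image)
    (h : σ.tangent 1 ≠ (‖σ 1 - p‖⁻¹ : ℝ) • (σ 1 - p)) :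
    ∃ γ, IsArcWithTangent (σ.tangent 1) (σ 1) p γ := by
  have hne : σ 1 ≠ p := fun h => hp (h ▸ σ.end_mem_image)
  have hpn : p - σ 1 ≠ 0 := sub_ne_zero.2 hne.symm
  have hslit : σ.chordDir 1 / (p - σ 1) ∈ Complex.slitPlane := by
    by_contra hs
    rw [Complex.mem_slitPlane_iff, not_or, not_lt, not_not] at hs
    set w := σ.chordDir 1 / (p - σ 1) with hw
    have hw0 : w ≠ 0 := div_ne_zero (σ.chordDir_ne_zero 1) hpn
    have hwr : w = ((w.re : ℝ) : ℂ) := Complex.ext (by simp) (by simp [hs.2])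
    have hre : w.re < 0 := lt_of_le_of_ne hs.1 fun h0 => hw0 (by rw [hwr, h0, Complex.ofReal_zero])
    have hn : 0 < ‖σ 1 - p‖ := norm_pos_iff.2 (sub_ne_zero.2 hne)
    refine h (tangent_of_chordDir (k := -w.re * ‖σ 1 - p‖) (by nlinarith) ?_ ?_)
    · rw [norm_smul, norm_inv, norm_norm, inv_mul_cancel₀ hn.ne']
    · have hn' : (‖σ 1 - p‖ : ℂ) ≠ 0 := by exact_mod_cast hn.ne'
      rw [eq_div_iff hpn, hwr] at hw
      rw [Complex.real_smul]
      push_cast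
      rw [← hw]
      field_simp
      ring
  obtain ⟨γ, h0, h1, -, k, hk, hd⟩ := exists_arc_of_dir hne hslit
  have hn := σ.norm_sub_pos
  refine ⟨γ, h0, h1, tangent_of_chordDir (k := k * ‖σ 1 - σ 0‖) (by positivity)
    (σ.norm_tangent 1) ?_⟩
  have hn' : (‖σ 1 - σ 0‖ : ℂ) ≠ 0 := by exact_mod_cast hn.ne'
  rw [hd, tangent_eq_chordDir]
  push_cast
  field_simp

/-- The tangential arc at the end of `σ` does not meet `σ` again, and `σ` is not to its left. -/
lemma side_tangential {σ γ : Arc} {p : ℂ} (hp : p ∉ σ.image) (hp0 : 0 ≤ (σ.side p).im)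
    (hγ : IsArcWithTangent (σ.tangent 1) (σ 1) p γ) {s : ℝ} (hs : s ∈ Ico (0 : ℝ) 1) :
    (γ.side (σ s)).im ≤ 0 ∧ σ s ∉ γ.image := by
  obtain ⟨h0, h1, ht⟩ := hγ
  obtain ⟨k, hk, hd⟩ := chordDir_eq_of_tangent_eq ht
  rw [chordDir_zero, chordDir_one, h0, h1] at hd
  have hn := pow_pos σ.norm_sub_pos 2
  have hpn : 0 < ‖p - σ 1‖ ^ 2 := by
    rw [← h0, ← h1]; exact pow_pos γ.norm_sub_pos 2
  have hm := Complex.mul_conj' (σ 1 - σ 0)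
  have hm' := Complex.mul_conj' (p - σ 1)
  have e := cis_mul_cis_neg σ.ang
  have hb : γ.bend σ = ((k * ‖σ 1 - σ 0‖ ^ 2 : ℝ) : ℂ) := by
    push_cast
    rw [bend, h0, h1, ← hm]
    simp only [map_sub]
    linear_combination (conj (σ 1) - conj (σ 0)) * cis (-σ.ang) * hd +
      k * (σ 1 - σ 0) * (conj (σ 1) - conj (σ 0)) * e
  -- By tangency at `σ 1`, the start of `σ` lies relative to `γ` as the mirror image of how `p` lies
  -- relative to `σ`.
  have hx : ((‖p - σ 1‖ ^ 2 : ℝ) : ℂ) * γ.side (σ 0) =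
      ((k * ‖σ 1 - σ 0‖ ^ 2 : ℝ) : ℂ) * conj (σ.side p) := by
    push_cast
    rw [side, side, h0, h1, ← hm, ← hm']
    simp only [map_sub, map_mul, conj_cis, neg_neg, Complex.conj_conj]
    linear_combination (p - σ 0) * (conj (σ 1) - conj (σ 0)) * (conj p - conj (σ 1)) * hd
  have hxi : ‖p - σ 1‖ ^ 2 * (γ.side (σ 0)).im = -(k * ‖σ 1 - σ 0‖ ^ 2 * (σ.side p).im) := by
    have := congrArg Complex.im hx
    rwa [Complex.im_ofReal_mul, Complex.im_ofReal_mul, Complex.conj_im, mul_neg] at this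
  have hxr : ‖p - σ 1‖ ^ 2 * (γ.side (σ 0)).re = k * ‖σ 1 - σ 0‖ ^ 2 * (σ.side p).re := by
    have := congrArg Complex.re hx
    rwa [Complex.re_ofReal_mul, Complex.re_ofReal_mul, Complex.conj_re] at this
  have hxle : (γ.side (σ 0)).im ≤ 0 := by
    by_contra! hc
    have h1 := mul_pos hpn hc
    have h2 := mul_nonneg (mul_pos hk hn).le hp0
    linarith
  have hend : γ.side (σ 1) = 0 := by rw [← h0, side_start]
  have a := σ.wt_pos (t := 1 - s) (by linarith [hs.2]) (by linarith [hs.1])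
  have b := σ.wt_nonneg hs.1 hs.2.le
  have him : (γ.side (σ s)).im = (γ.side (σ 0)).im * σ.wt (1 - s) ^ 2 := by
    rw [side_path_im_of_end (by rw [hend]; rfl), hb, Complex.ofReal_im]
    ring
  -- If `σ s` lay on `γ`, both arcs would have the same circle or line. Then `p`, being off `σ`, has
  -- positive `side`, which makes `γ.side (σ s)` positive as well.
  refine ⟨by rw [him]; exact mul_nonpos_of_nonpos_of_nonneg hxle (by positivity), fun hmem => ?_⟩
  rw [mem_image_iff, him] at hmem
  have hx0 : (γ.side (σ 0)).im = 0 := (mul_eq_zero.1 hmem.1).resolve_right (pow_pos a 2).ne'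
  have hp0' : (σ.side p).im = 0 := by
    rw [hx0, mul_zero, zero_eq_neg] at hxi
    exact (mul_eq_zero.1 hxi).resolve_left (mul_pos hk hn).ne'
  have hpr : 0 < (σ.side p).re := by
    by_contra! hc
    exact hp (mem_image_iff.2 ⟨hp0', hc⟩)
  have hxr' : 0 < (γ.side (σ 0)).re := by
    have : 0 < ‖p - σ 1‖ ^ 2 * (γ.side (σ 0)).re := by rw [hxr]; positivity
    exact (mul_pos_iff_of_pos_left hpn).1 this
  have hre : (γ.side (σ s)).re = (γ.side (σ 0)).re * σ.wt (1 - s) ^ 2 +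
      k * ‖σ 1 - σ 0‖ ^ 2 * (σ.wt s * σ.wt (1 - s)) := by
    rw [side_path, hb, hend]
    simp only [zero_mul, add_zero, Complex.add_re, ← Complex.ofReal_pow, ← Complex.ofReal_mul,
      Complex.re_mul_ofReal, Complex.ofReal_re]
  have : 0 < (γ.side (σ s)).re := by rw [hre]; positivity
  linarith [hmem.2]

lemma im_mul_conj_eq_inner (u v : ℂ) : (v * conj u).im = Inner.inner ℝ (Complex.I * u) v := by
  rw [Complex.inner]; simp; ring

/-- A connecting arc that starts before the end of `σ` does not pass through the end of `σ`. -/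
lemma end_notMem_image_of_mem_connecting {σ γ : Arc} {p : ℂ} (hp : p ∉ σ.image)
    (hp0 : StrictlyLeft p σ ∨ p ∈ σ.carrier) (hγ : γ ∈ σ.connecting p) (hs : γ 0 ≠ σ 1) :
    σ 1 ∉ γ.image := by
  have hσ1 : (σ.side (σ 1)).im = 0 := by simp
  have hne : σ 1 ≠ p := fun h => hp (h ▸ σ.end_mem_image)
  rcases hγ with ⟨hc, hγ⟩ | ⟨hc, hγ | ⟨g0, g1, gt⟩ | ⟨g0, g1, gt⟩⟩
  · obtain ⟨h0, h1, hb⟩ := mem_arcClosure_star hγ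
    have hpos := (strictlyLeft_iff _ _).1 (hp0.resolve_right hc)
    rintro ⟨t, ht, he⟩
    have ht0 : 0 < t := lt_of_le_of_ne ht.1 (by rintro rfl; exact hs he)
    rw [← he, side_path_im_of_start (side_im_of_mem_image h0), h1] at hσ1
    have a := γ.wt_pos ht0 ht.2
    have b := γ.wt_nonneg (t := 1 - t) (by linarith [ht.2]) (by linarith)
    have : 0 < γ.wt t * ((σ.bend γ).im * γ.wt (1 - t) + (σ.side p).im * γ.wt t) := by positivity
    exact this.ne' hσ1
  · obtain ⟨s, hs', τ, hτ, hin, g0, g1, gt⟩ := hγ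
    have hb : 0 < (σ.bend γ).im := by
      rw [← gt, normal, ← im_mul_conj_eq_inner, tangent_eq_chordDir, tangent_eq_chordDir, map_mul,
        Complex.conj_ofReal, mul_mul_mul_comm, ← Complex.ofReal_mul, Complex.im_ofReal_mul] at hin
      rw [bend_im_eq_cross g0]
      have := γ.norm_sub_pos
      have := σ.norm_sub_pos
      exact (mul_pos_iff_of_pos_left (by positivity)).1 hin
    rintro ⟨t, ht, he⟩
    have ht0 : 0 < t := lt_of_le_of_ne ht.1 (by rintro rfl; exact hs he)
    have ht1 : t < 1 := lt_of_le_of_ne ht.2 (by rintro rfl; exact hne (he.symm.trans g1))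
    rw [← he, side_path_im_of_start (g0 ▸ side_im_of_mem_carrier ⟨_, rfl⟩), g1,
      side_im_of_mem_carrier hc] at hσ1
    have a := γ.wt_pos ht0 ht.2
    have b := γ.wt_pos (t := 1 - t) (by linarith) (by linarith)
    have : 0 < γ.wt t * ((σ.bend γ).im * γ.wt (1 - t) + 0 * γ.wt t) := by positivity
    exact this.ne' hσ1
  · obtain ⟨k, hk, hd⟩ := chordDir_eq_of_tangent_eq_mul (δ := σ) (t := 0) (c := -1)
      (by rw [gt]; ring)
    rw [chordDir_zero, chordDir_zero, g0, g1] at hd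
    have hm := Complex.mul_conj' (σ 1 - σ 0)
    have hm' := Complex.mul_conj' (p - σ 0)
    -- Here `γ` runs backwards along the circle or line of `σ`. Up to a positive factor `σ 1`
    -- relative to `γ` is like `p` relative to `σ`, hence off the arc.
    have hx : ((‖p - σ 0‖ ^ 2 : ℝ) : ℂ) * γ.side (σ 1) =
        ((k * ‖σ 1 - σ 0‖ ^ 2 : ℝ) : ℂ) * σ.side p := by
      push_cast
      rw [side, side, g0, g1, ← hm, ← hm']
      simp only [map_sub]
      linear_combination (conj p - conj (σ 0)) * (p - σ 1) * (conj (σ 0) - conj (σ 1)) * hd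
    have hpr : 0 < (σ.side p).re := by
      by_contra! h
      exact hp (mem_image_iff.2 ⟨side_im_of_mem_carrier hc, h⟩)
    have hxr := congrArg Complex.re hx
    rw [Complex.re_ofReal_mul, Complex.re_ofReal_mul] at hxr
    intro hmem
    have h1 := (mem_image_iff.1 hmem).2
    have h2 := mul_nonpos_of_nonneg_of_nonpos (sq_nonneg ‖p - σ 0‖) h1
    have h3 := mul_pos (mul_pos hk (pow_pos σ.norm_sub_pos 2)) hpr
    linarith
  · exact absurd g0 hs

lemma start_end_of_mem_connecting {σ γ : Arc} {p : ℂ} (hγ : γ ∈ σ.connecting p) :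
    γ 0 ∈ σ.image ∧ γ 1 = p := by
  rcases hγ with ⟨hc, hγ⟩ | ⟨hc, ⟨s, hs', τ, hτ, hin, g0, g1, gt⟩ | ⟨g0, g1, gt⟩ | ⟨g0, g1, gt⟩⟩
  · obtain ⟨h0, h1, -⟩ := mem_arcClosure_star hγ
    exact ⟨h0, h1⟩
  · exact ⟨⟨s, hs', g0.symm⟩, g1⟩
  · exact ⟨g0 ▸ σ.start_mem_image, g1⟩
  · exact ⟨g0 ▸ σ.end_mem_image, g1⟩

lemma not_prec_start {σ : Arc} {z : ℂ} : ¬ σ.Prec z (σ 0) := by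
  rintro ⟨s, hs, t, ht, -, h, hst⟩
  have := σ.path_injOn ht (by simp) h
  linarith [hs.1]

lemma not_prec_end {σ : Arc} {z : ℂ} : ¬ σ.Prec (σ 1) z := by
  rintro ⟨s, hs, t, ht, h, -, hst⟩
  have := σ.path_injOn hs (by simp) h
  linarith [ht.2]

/-- All connecting arcs from other points of `σ` start earlier and do not cut `γ`, so they are
smaller and not larger. For arcs from `σ 1` the inner product of unit vectors is at most 1, with
equality only for equal tangents. -/
theorem isMaximalConnecting_tangential {σ γ : Arc} {p : ℂ} (hp : p ∉ σ.image)
    (hp0 : StrictlyLeft p σ ∨ p ∈ σ.carrier) (hγ : IsArcWithTangent (σ.tangent 1) (σ 1) p γ) :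
    σ.IsMaximalConnecting p γ := by
  have hside : 0 ≤ (σ.side p).im := by
    rcases hp0 with h | h
    · exact ((strictlyLeft_iff _ _).1 h).le
    · exact (side_im_of_mem_carrier h).ge
  have hcut : ∀ γ' ∈ σ.connecting p, γ' 0 ≠ σ 1 →
      σ.Prec (γ' 0) (γ 0) ∧ γ'.extCutsFromLeft γ = ∅ := by
    intro γ' hγ' hne
    obtain ⟨⟨s, hs, h0⟩, h1⟩ := start_end_of_mem_connecting hγ'
    have hs1 : s < 1 := lt_of_le_of_ne hs.2 (by rintro rfl; exact hne h0.symm)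
    obtain ⟨h2, h3⟩ := side_tangential hp hside hγ ⟨hs.1, hs1⟩
    refine ⟨⟨s, hs, 1, by simp, h0, hγ.1.symm, hs1⟩, ?_⟩
    refine extCutsFromLeft_eq_empty (h1.trans hγ.2.1.symm) (by rwa [← h0]) (by rwa [← h0]) ?_
    rw [hγ.1]
    exact end_notMem_image_of_mem_connecting hp hp0 hγ' hne
  refine ⟨?_, fun γ' hγ' => ?_, fun γ' hγ' hle => ?_⟩
  · by_cases hc : p ∈ σ.carrier
    · exact Or.inr ⟨hc, Or.inr (Or.inr hγ)⟩
    · exact Or.inl ⟨hc, tangential_mem_arcClosure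
        ((strictlyLeft_iff _ _).1 (hp0.resolve_right hc)) hγ⟩
  · by_cases hne : γ' 0 = σ 1
    · refine Or.inr (Or.inr ⟨1, by simp, hne, hγ.1, ?_⟩)
      rw [hγ.2.2, real_inner_self_eq_norm_sq, norm_tangent]
      refine (real_inner_le_norm _ _).trans ?_
      simp [norm_tangent]
    · exact Or.inl (hcut γ' hγ' hne)
  · by_cases hne : γ' 0 = σ 1
    · have hin : 1 ≤ Inner.inner ℝ (σ.tangent 1) (γ'.tangent 0) := by
        rcases hle with ⟨h, -⟩ | ⟨h, -⟩ | ⟨t, ht, h0, -, hin⟩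
        · exact absurd (hγ.1 ▸ h) not_prec_end
        · exact absurd (hne ▸ h) not_prec_end
        · obtain rfl : t = 1 := σ.path_injOn ht (by simp) (h0.symm.trans hγ.1)
          rwa [hγ.2.2, real_inner_self_eq_norm_sq, norm_tangent, one_pow] at hin
      have heq : Inner.inner ℝ (σ.tangent 1) (γ'.tangent 0) = (1 : ℝ) :=
        le_antisymm ((real_inner_le_norm _ _).trans (by simp [norm_tangent])) hin
      have := (inner_eq_one_iff_of_norm_eq_one (σ.norm_tangent 1) (γ'.norm_tangent 0)).1 heq
      exact IsArcWithTangent.unique ⟨hne, (start_end_of_mem_connecting hγ').2, this.symm⟩ hγ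
    · obtain ⟨h1, h2⟩ := hcut γ' hγ' hne
      rcases hle with ⟨h, -⟩ | ⟨-, h⟩ | ⟨t, ht, h0, h0', -⟩
      · exact absurd (hγ.1 ▸ h) not_prec_end
      · exact absurd h2 h
      · exact absurd (h0'.trans (h0.symm.trans hγ.1)) hne

/-! ### The arc through both endpoints of the starting arc. -/

/-- The opening angle of an arc through `y`. -/
lemma cis_neg_ang_of_mem {γ : Arc} {y : ℂ} (h0 : y ≠ γ 0) (h1 : y ≠ γ 1) (h : y ∈ γ.image) :
    ∃ k : ℝ, 0 < k ∧ cis (-γ.ang) = k * (conj (γ 1 - y) * (y - γ 0)) := by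
  obtain ⟨him, hre⟩ := mem_image_iff.1 h
  have hs : γ.side y ≠ 0 := mul_ne_zero (mul_ne_zero (cis_ne_zero _) (sub_ne_zero.2 h1.symm))
    ((map_ne_zero _).2 (sub_ne_zero.2 h0.symm))
  have hsr : γ.side y = (((γ.side y).re : ℝ) : ℂ) := Complex.ext (by simp) (by simp [him])
  have hre' : (γ.side y).re < 0 :=
    lt_of_le_of_ne hre fun h => hs (by rw [hsr, h, Complex.ofReal_zero])
  have n0 : 0 < ‖y - γ 0‖ := norm_pos_iff.2 (sub_ne_zero.2 h0)
  have n1 : 0 < ‖γ 1 - y‖ := norm_pos_iff.2 (sub_ne_zero.2 h1.symm)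
  have n0' : (‖y - γ 0‖ : ℂ) ≠ 0 := by exact_mod_cast n0.ne'
  have n1' : (‖γ 1 - y‖ : ℂ) ≠ 0 := by exact_mod_cast n1.ne'
  refine ⟨-(γ.side y).re * (‖y - γ 0‖ ^ 2)⁻¹ * (‖γ 1 - y‖ ^ 2)⁻¹,
    mul_pos (mul_pos (neg_pos.2 hre') (by positivity)) (by positivity), ?_⟩
  push_cast
  rw [← hsr, side]
  have e0 := Complex.mul_conj' (y - γ 0)
  have e1 := Complex.mul_conj' (γ 1 - y)
  field_simp
  rw [← e0, ← e1]
  simp only [map_sub]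
  ring

lemma ang_eq_of_cis {γ : Arc} {k : ℝ} {m : ℂ} (hk : 0 < k) (h : cis (-γ.ang) = k * m) :
    γ.ang = -m.arg ∧ m ∈ Complex.slitPlane := by
  have hk' : (k : ℂ) ≠ 0 := by exact_mod_cast hk.ne'
  have e : m = (k⁻¹ : ℝ) * cis (-γ.ang) := by
    rw [h]; push_cast; field_simp
  have := arg_mul_cis (inv_pos.2 hk) (θ := -γ.ang) (by rw [abs_neg]; exact γ.abs_ang_lt)
  rw [e]
  exact ⟨by rw [this.1, neg_neg], this.2⟩

/-- The arc from `x` to `p` through `y`. -/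
lemma exists_arc_through {x y p : ℂ} (hxp : x ≠ p)
    (hm : conj (p - y) * (y - x) ∈ Complex.slitPlane) :
    ∃ γ : Arc, γ 0 = x ∧ γ 1 = p ∧ γ.ang = -(conj (p - y) * (y - x)).arg ∧ y ∈ γ.image := by
  obtain ⟨γ, h0, h1, ha⟩ := exists_arc hxp (φ := -(conj (p - y) * (y - x)).arg)
    (by rw [abs_neg]; exact abs_arg_lt_pi hm)
  refine ⟨γ, h0, h1, ha, ?_⟩
  -- Without its rotation, `side` at `y` is minus the conjugate of `conj (p - y) * (y - x)`. The
  -- chosen angle cancels its phase.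
  have hs : γ.side y = ((-‖conj (p - y) * (y - x)‖ : ℝ) : ℂ) := by
    have hm0 := Complex.slitPlane_ne_zero hm
    have hn : (‖conj (p - y) * (y - x)‖ : ℂ) ≠ 0 := by
      exact_mod_cast (norm_pos_iff.2 hm0).ne'
    have e := Complex.mul_conj' (conj (p - y) * (y - x))
    rw [side, h0, h1, ha, neg_neg, cis_arg hm0]
    push_cast
    rw [div_mul_eq_mul_div, div_mul_eq_mul_div, div_eq_iff hn]
    simp only [map_sub, map_mul, Complex.conj_conj] at e ⊢
    linear_combination -e
  rw [mem_image_iff, hs]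
  exact ⟨Complex.ofReal_im _, by rw [Complex.ofReal_re]; exact neg_nonpos.2 (norm_nonneg _)⟩

/-- Off the slit plane, `p - y` is a nonnegative multiple `l` of `x - y`. If `l ≤ 1`, then `p` is on
the segment from `x` to `y`; if `l > 1`, then `x` is on the one from `p` to `y`. -/
lemma slitPlane_of_notMem_segment {x y p : ℂ} (hxy : x ≠ y)
    (h1 : p ∉ segment ℝ x y) (h2 : x ∉ segment ℝ p y) :
    conj (p - y) * (y - x) ∈ Complex.slitPlane := by
  by_contra hs
  rw [Complex.mem_slitPlane_iff, not_or, not_lt, not_not] at hs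
  set w := conj (p - y) * (y - x) with hw
  have hwr : w = ((w.re : ℝ) : ℂ) := Complex.ext (by simp) (by simp [hs.2])
  have n0 : 0 < ‖y - x‖ ^ 2 := pow_pos (norm_pos_iff.2 (sub_ne_zero.2 hxy.symm)) 2
  have n0' : ((‖y - x‖ ^ 2 : ℝ) : ℂ) ≠ 0 := by exact_mod_cast n0.ne'
  obtain ⟨l, hl, hp⟩ : ∃ l : ℝ, 0 ≤ l ∧ p - y = l * (x - y) := by
    refine ⟨-w.re / ‖y - x‖ ^ 2, div_nonneg (by linarith [hs.1]) n0.le, ?_⟩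
    have e := Complex.mul_conj' (y - x)
    have hc := congrArg conj hw
    rw [hwr, Complex.conj_ofReal] at hc
    simp only [map_mul, Complex.conj_conj] at hc
    rw [Complex.ofReal_div, div_mul_eq_mul_div, eq_div_iff n0']
    push_cast
    linear_combination -(p - y) * e + (x - y) * hc
  rcases le_or_gt l 1 with h | h
  · refine h1 ⟨l, 1 - l, hl, by linarith, by ring, ?_⟩
    simp only [Complex.real_smul]
    push_cast
    linear_combination -hp
  · have hl0 : (l : ℂ) ≠ 0 := by exact_mod_cast (by linarith : l ≠ 0)
    refine h2 ⟨l⁻¹, 1 - l⁻¹, by positivity, ?_, by ring, ?_⟩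
    · rw [sub_nonneg]; exact inv_le_one_of_one_le₀ h.le
    · simp only [Complex.real_smul]
      push_cast
      field_simp
      linear_combination hp

lemma IsArcThrough.unique {x y p : ℂ} (hxy : x ≠ y) (hyp : y ≠ p) {γ δ : Arc}
    (hγ : IsArcThrough x y p γ) (hδ : IsArcThrough x y p δ) : γ = δ := by
  obtain ⟨h0, h1, h⟩ := hγ
  obtain ⟨h0', h1', h'⟩ := hδ
  obtain ⟨k, hk, e⟩ := cis_neg_ang_of_mem (h0 ▸ hxy.symm) (h1 ▸ hyp) h
  obtain ⟨k', hk', e'⟩ := cis_neg_ang_of_mem (h0' ▸ hxy.symm) (h1' ▸ hyp) h'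
  refine ext_ang (h0.trans h0'.symm) (h1.trans h1'.symm) ?_
  rw [(ang_eq_of_cis hk e).1, (ang_eq_of_cis hk' e').1, h0, h1, h0', h1']

/-- Both sides are the equation in `z` of the circle or line through `x`, `y`, `p`, once with
respect to the chord from `x` to `p` and once with respect to the chord from `x` to `y`. -/
lemma im_circle_pencil (x y p z : ℂ) :
    (conj (p - y) * (y - x) * (p - z) * conj (x - z)).im =
      (conj (y - p) * (x - p) * ((y - z) * conj (x - z))).im := by
  simp only [Complex.mul_im, Complex.mul_re, Complex.sub_im, Complex.sub_re, Complex.conj_im,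
    Complex.conj_re]
  ring

section through

variable {σ γ : Arc} {p : ℂ} {k : ℝ}

/-- The circles and lines through `σ 0` and `σ 1` are the loci where `σ.side` has a fixed argument
modulo π. The one of `γ` is singled out by the value at `p`. -/
lemma side_im_through (h0 : γ 0 = σ 0) (h1 : γ 1 = p)
    (hk : cis (-γ.ang) = k * (conj (p - σ 1) * (σ 1 - σ 0))) (z : ℂ) :
    (γ.side z).im = k * (conj (σ.side p) * σ.side z).im := by
  have e1 : γ.side z = k * (conj (p - σ 1) * (σ 1 - σ 0) * (p - z) * conj (σ 0 - z)) := by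
    rw [side, hk, h0, h1]; ring
  have e2 : conj (σ.side p) * σ.side z =
      conj (σ 1 - p) * (σ 0 - p) * ((σ 1 - z) * conj (σ 0 - z)) := by
    have e := cis_mul_cis_neg σ.ang
    simp only [side, map_mul, conj_cis, neg_neg, Complex.conj_conj]
    linear_combination (conj (σ 1 - p) * (σ 0 - p) * ((σ 1 - z) * conj (σ 0 - z))) * e
  rw [e1, e2, Complex.im_ofReal_mul, im_circle_pencil]

/-- For `p` strictly right of `σ` and `0 < k`, this says that inner points of `σ` are strictly right
of `γ`, and points of the circle or line beyond `σ` strictly left. -/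
lemma side_im_through_of_im_eq_zero (h0 : γ 0 = σ 0) (h1 : γ 1 = p)
    (hk : cis (-γ.ang) = k * (conj (p - σ 1) * (σ 1 - σ 0))) {z : ℂ} (hz : (σ.side z).im = 0) :
    (γ.side z).im = k * (-(σ.side p).im * (σ.side z).re) := by
  rw [side_im_through h0 h1 hk, Complex.mul_im, hz, Complex.conj_im]
  ring

/-- A point of the circle or line of `γ` that is not strictly right of `σ` lies on `γ`. -/
lemma mem_image_through (h0 : γ 0 = σ 0) (h1 : γ 1 = p) (hkp : 0 < k)
    (hk : cis (-γ.ang) = k * (conj (p - σ 1) * (σ 1 - σ 0))) (hp : (σ.side p).im < 0) {z : ℂ}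
    (hz : (γ.side z).im = 0) (hzs : 0 ≤ (σ.side z).im) : z ∈ γ.image := by
  refine mem_image_iff.2 ⟨hz, ?_⟩
  rw [side_im_through h0 h1 hk, Complex.mul_im, Complex.conj_im, Complex.conj_re] at hz
  have hz' := (mul_eq_zero.1 hz).resolve_left hkp.ne'
  set r := (σ.side z).im / (σ.side p).im with hr
  have hr0 : r ≤ 0 := div_nonpos_of_nonneg_of_nonpos hzs hp.le
  have hrim : (σ.side z).im = r * (σ.side p).im := by rw [hr, div_mul_cancel₀ _ hp.ne]
  have hN : σ.side z = r * σ.side p := by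
    apply Complex.ext
    · rw [Complex.re_ofReal_mul]
      apply mul_right_cancel₀ hp.ne
      rw [hrim] at hz'
      linarith
    · rw [Complex.im_ofReal_mul, hrim]
  have H : (σ 1 - z) * conj (σ 0 - z) = r * ((σ 1 - p) * conj (σ 0 - p)) := by
    simp only [side] at hN
    apply mul_left_cancel₀ (cis_ne_zero (-σ.ang))
    linear_combination hN
  have e : γ.side z = ((k * ‖σ 1 - p‖ ^ 2 * (r * ‖σ 0 - p‖ ^ 2 - ‖σ 0 - z‖ ^ 2) : ℝ) : ℂ) := by
    have e1 := Complex.mul_conj' (σ 1 - p)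
    have e2 := Complex.mul_conj' (σ 0 - p)
    have e3 := Complex.mul_conj' (σ 0 - z)
    push_cast
    rw [← e1, ← e2, ← e3, side, hk, h0, h1]
    simp only [map_sub] at H ⊢
    linear_combination (k * (conj (σ 1) - conj p) * (σ 0 - p)) * H
  rw [e, Complex.ofReal_re]
  have := mul_nonpos_of_nonpos_of_nonneg hr0 (sq_nonneg ‖σ 0 - p‖)
  exact mul_nonpos_of_nonneg_of_nonpos (by positivity) (by nlinarith [sq_nonneg ‖σ 0 - z‖])

/-- A connecting arc in the narrow sense leaves the left side of `σ` only to the left of `γ`. -/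
lemma side_nonneg_of_mem_star (h0 : γ 0 = σ 0) (h1 : γ 1 = p) (hkp : 0 < k)
    (hk : cis (-γ.ang) = k * (conj (p - σ 1) * (σ 1 - σ 0))) (hp : (σ.side p).im < 0) {δ : Arc}
    (hδ : δ ∈ σ.connectingStar p) {t : ℝ} (ht : t ∈ Icc (0 : ℝ) 1) :
    0 ≤ (σ.side (δ t)).im ∨ 0 ≤ (γ.side (δ t)).im := by
  have hβ0 := bend_im_nonneg_of_mem_star hδ
  obtain ⟨hin, hint, d1, -, -, hev⟩ := hδ
  have hmem := σ.inner_subset_image hin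
  have hs0 := side_im_of_mem_image hmem
  have hend : (γ.side (δ 1)).im = 0 := by rw [d1, ← h1, side_end, Complex.zero_im]
  have hP0 : (γ.side (δ 0)).im ≤ 0 := by
    rw [side_im_through_of_im_eq_zero h0 h1 hk hs0]
    have := (mem_image_iff.1 hmem).2
    exact mul_nonpos_of_nonneg_of_nonpos hkp.le
      (mul_nonpos_of_nonneg_of_nonpos (neg_nonneg.2 hp.le) this)
  have hβ : 0 < (σ.bend δ).im := by
    obtain ⟨ε, hl, hε⟩ := (hev.and (Ioo_mem_nhdsGT zero_lt_one)).exists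
    rw [strictlyLeft_iff, zero_add, side_path_im_of_start hs0, d1] at hl
    have b := δ.wt_pos hε.1 hε.2.le
    have hl' := (mul_pos_iff_of_pos_left b).1 hl
    refine lt_of_le_of_ne hβ0 fun h => ?_
    rw [← h, zero_mul, zero_add] at hl'
    nlinarith
  -- The weight ratio at which `δ` returns to the circle or line of `σ`. This happens off `σ`, hence
  -- strictly left of `γ`.
  set l := (σ.bend δ).im / -(σ.side p).im with hl
  have hl0 : 0 < l := div_pos hβ (neg_pos.2 hp)
  have hlβ : (σ.bend δ).im = l * -(σ.side p).im := by
    rw [hl, div_mul_cancel₀ _ (neg_pos.2 hp).ne']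
  obtain ⟨u, hu, hw⟩ := δ.exists_wt_eq hl0.le
  have hu0 : 0 < u := lt_of_le_of_ne hu.1 (by rintro rfl; simp at hw; exact hl0.ne hw)
  have au := δ.wt_pos (t := 1 - u) (by linarith [hu.2]) (by linarith)
  have hzu : (σ.side (δ u)).im = 0 := by
    rw [side_path_im_of_start hs0, d1, hw, hlβ]; ring
  have hnot : δ u ∉ σ.image := by
    intro h
    have : δ u ∈ δ.image ∩ σ.image := ⟨⟨u, ⟨hu.1, hu.2.le⟩, rfl⟩, h⟩
    rw [hint] at this
    exact hu0.ne' (δ.path_injOn ⟨hu.1, hu.2.le⟩ (by simp) this)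
  have hre : 0 < (σ.side (δ u)).re := by
    by_contra! h
    exact hnot (mem_image_iff.2 ⟨hzu, h⟩)
  have hγu : 0 < (γ.side (δ u)).im := by
    rw [side_im_through_of_im_eq_zero h0 h1 hk hzu]
    exact mul_pos hkp (mul_pos (neg_pos.2 hp) hre)
  rw [side_path_im_of_end hend, hw] at hγu
  have h2 := (mul_pos_iff_of_pos_left au).1 hγu
  -- The linear form of `γ.side` along `δ` is nonpositive at ratio 0 and positive at ratio `l`, so
  -- it is increasing and positive beyond `l`. Up to ratio `l`, the arc is not strictly right of
  -- `σ`.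
  have h3 : 0 < (γ.side (δ 0)).im + (γ.bend δ).im * l := by
    refine (mul_pos_iff_of_pos_left au).1 ?_
    linarith
  have hβ2 : 0 < (γ.bend δ).im := by
    by_contra! h
    nlinarith
  by_contra! hcon
  have hc1 := hcon.1
  have hc2 := hcon.2
  have a := δ.wt_nonneg (t := 1 - t) (by linarith [ht.2]) (by linarith [ht.1])
  have b := δ.wt_nonneg ht.1 ht.2
  rw [side_path_im_of_start hs0, d1, hlβ] at hc1
  rw [side_path_im_of_end hend] at hc2
  have h4 : l * δ.wt (1 - t) ≤ δ.wt t := by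
    by_contra! h
    have : 0 ≤ δ.wt t * (-(σ.side p).im * (l * δ.wt (1 - t) - δ.wt t)) :=
      mul_nonneg b (mul_nonneg (neg_nonneg.2 hp.le) (by linarith))
    linarith
  have h5 : 0 ≤ δ.wt (1 - t) * ((γ.side (δ 0)).im * δ.wt (1 - t) + (γ.bend δ).im * δ.wt t) := by
    refine mul_nonneg a ?_
    nlinarith [mul_nonneg a h3.le, mul_le_mul_of_nonneg_left h4 hβ2.le]
  linarith

end through

/-! ### From meeting to cutting. -/

/-- If `α` starts strictly right of `γ` and meets it, then `γ` starts strictly left of `α`. -/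
lemma side_start_pos_of_meet {α γ : Arc} (h1 : α 1 = γ 1) {s t : ℝ} (hs : s ∈ Ioo (0 : ℝ) 1)
    (ht : t ∈ Ioo (0 : ℝ) 1) (h : α s = γ t) (h0 : (γ.side (α 0)).im < 0) :
    0 < (α.side (γ 0)).im := by
  have a := γ.wt_pos (t := 1 - t) (by linarith [ht.2]) (by linarith [ht.1])
  have b := γ.wt_pos ht.1 ht.2.le
  have a' := α.wt_pos (t := 1 - s) (by linarith [hs.2]) (by linarith [hs.1])
  have b' := α.wt_pos hs.1 hs.2.le
  have key : ∀ (γ : Arc) (t : ℝ),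
      (γ t - γ 1) * (γ.wt (1 - t) + cis (-γ.ang) * γ.wt t) = (γ 0 - γ 1) * γ.wt (1 - t) := by
    intro γ t
    have e := γ.cis_wt t
    have e4 : cis (γ.ang * (t - 1)) = cis (-γ.ang) * cis (γ.ang * t) := by
      rw [← cis_add]; congr 1; ring
    rw [e4] at e
    rw [path_sub_end]
    linear_combination (γ 0 - γ 1) * γ.wt (1 - t) * e
  have kγ := key γ t
  have kα := key α s
  rw [h, h1] at kα
  -- Eliminating the common point between `kγ` and `kα`. After rescaling by positive reals, the two
  -- `side` values then involve `W` and `conj W`, apart from real summands, so their imaginary parts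
  -- have opposite signs.
  have K : γ.wt (1 - t) * α.wt (1 - s) * (γ 0 - α 0) =
      (α 0 - γ 1) * α.wt (1 - s) * cis (-γ.ang) * γ.wt t -
        (γ 0 - γ 1) * γ.wt (1 - t) * cis (-α.ang) * α.wt s := by
    linear_combination (α.wt (1 - s) + cis (-α.ang) * α.wt s) * kγ * (-1) +
      (γ.wt (1 - t) + cis (-γ.ang) * γ.wt t) * kα
  have Kc := congrArg conj K
  simp only [map_mul, map_sub, conj_cis, Complex.conj_ofReal, neg_neg] at Kc
  set W := cis (-γ.ang) * (α 0 - γ 1) * conj (cis (-α.ang) * (γ 0 - γ 1)) with hW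
  have e := cis_mul_cis_neg γ.ang
  have e' := cis_mul_cis_neg α.ang
  have m := Complex.mul_conj' (α 0 - γ 1)
  have m' := Complex.mul_conj' (γ 0 - γ 1)
  have E1 : ((γ.wt (1 - t) * α.wt (1 - s) : ℝ) : ℂ) * γ.side (α 0) =
      ((γ.wt (1 - t) * α.wt s : ℝ) : ℂ) * W -
        ((α.wt (1 - s) * γ.wt t * ‖α 0 - γ 1‖ ^ 2 : ℝ) : ℂ) := by
    push_cast
    rw [side, hW, ← m]
    simp only [map_mul, map_sub, conj_cis, neg_neg]
    linear_combination -cis (-γ.ang) * (α 0 - γ 1) * Kc -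
      (α 0 - γ 1) * (conj (α 0) - conj (γ 1)) * α.wt (1 - s) * γ.wt t * e
  have E2 : ((γ.wt (1 - t) * α.wt (1 - s) : ℝ) : ℂ) * α.side (γ 0) =
      ((α.wt (1 - s) * γ.wt t : ℝ) : ℂ) * conj W -
        ((γ.wt (1 - t) * α.wt s * ‖γ 0 - γ 1‖ ^ 2 : ℝ) : ℂ) := by
    push_cast
    rw [side, hW, ← m', h1]
    simp only [map_mul, map_sub, conj_cis, neg_neg, Complex.conj_conj]
    linear_combination cis (-α.ang) * (γ 0 - γ 1) * Kc -
      (γ 0 - γ 1) * (conj (γ 0) - conj (γ 1)) * γ.wt (1 - t) * α.wt s * e'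
  have I1 := congrArg Complex.im E1
  have I2 := congrArg Complex.im E2
  rw [Complex.sub_im, Complex.im_ofReal_mul, Complex.im_ofReal_mul, Complex.ofReal_im,
    sub_zero] at I1 I2
  rw [Complex.conj_im] at I2
  have hWneg : W.im < 0 := by
    by_contra! hc
    have h2 := mul_nonneg (mul_pos a b').le hc
    have h3 := mul_neg_of_pos_of_neg (mul_pos a a') h0
    linarith
  refine (mul_pos_iff_of_pos_left (mul_pos a a')).1 ?_
  rw [I2]
  exact mul_pos (mul_pos a' b) (neg_pos.2 hWneg)

/-- Along `γ`, the linear form of `α.side` is positive at the start and vanishes at `t`. Its slope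
is therefore negative, and it changes sign there. -/
lemma mem_cutsFromLeft_of_meet {α γ : Arc} (h1 : α 1 = γ 1) {s t : ℝ} (hs : s ∈ Ioo (0 : ℝ) 1)
    (ht : t ∈ Ioo (0 : ℝ) 1) (h : α s = γ t) (h0 : (γ.side (α 0)).im < 0) :
    t ∈ γ.cutsFromLeft α := by
  have hpos := side_start_pos_of_meet h1 hs ht h h0
  have hend : (α.side (γ 1)).im = 0 := by rw [← h1, side_end, Complex.zero_im]
  have hin : γ t ∈ α.inner := ⟨s, hs, h⟩
  have hz := side_im_of_mem_image (α.inner_subset_image hin)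
  have a := γ.wt_pos (t := 1 - t) (by linarith [ht.2]) (by linarith [ht.1])
  have b := γ.wt_pos ht.1 ht.2.le
  rw [side_path_im_of_end hend] at hz
  have hz' := (mul_eq_zero.1 hz).resolve_left a.ne'
  have hform : ∀ u, γ.wt t * (α.side (γ u)).im =
      γ.wt (1 - u) * (α.side (γ 0)).im * (γ.wt t * γ.wt (1 - u) - γ.wt u * γ.wt (1 - t)) := by
    intro u
    rw [side_path_im_of_end hend]
    linear_combination γ.wt (1 - u) * γ.wt u * hz'
  refine ⟨⟨ht.1.le, ht.2.le⟩, t, ⟨ht.1.le, le_rfl⟩, ?_, ⟨⟨ht.1, ht.2.le⟩, hin, ?_⟩,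
    ⟨⟨ht.1.le, ht.2⟩, hin, ?_⟩⟩
  · intro u hu
    rw [le_antisymm hu.2 hu.1]
    exact α.inner_subset_image hin
  · filter_upwards [Ioo_mem_nhdsGT ht.1] with ε hε
    rw [strictlyLeft_iff]
    refine (mul_pos_iff_of_pos_left b).1 ?_
    rw [hform]
    have a' := γ.wt_pos (t := 1 - (t - ε)) (by linarith [hε.1, ht.2]) (by linarith [hε.2])
    exact mul_pos (mul_pos a' hpos) (sub_pos.2 (γ.wt_mul_lt (by linarith [hε.1])
      (by linarith [hε.2, ht.2])))
  · filter_upwards [Ioo_mem_nhdsGT (sub_pos.2 ht.2)] with ε hε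
    rw [strictlyRight_iff]
    by_contra! hc
    have h2 := mul_nonneg b.le hc
    rw [hform] at h2
    have a' := γ.wt_pos (t := 1 - (t + ε)) (by linarith [hε.2]) (by linarith [hε.1, ht.1])
    have := mul_pos (mul_pos a' hpos) (sub_pos.2 (γ.wt_mul_lt (s := t) (t := t + ε)
      (by linarith [hε.1]) (by linarith [hε.2, ht.1])))
    linarith

lemma extCutsFromLeft_ne_empty {α γ : Arc} (h : γ 0 ∉ α.image → α 0 ∉ γ.image →
    ∃ t, t ∈ γ.cutsFromLeft α) : γ.extCutsFromLeft α ≠ ∅ := by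
  rw [← nonempty_iff_ne_empty]
  by_cases h1 : γ 0 ∈ α.image
  · exact ⟨0, Or.inl ⟨h1, rfl⟩⟩
  by_cases h2 : α 0 ∈ γ.image
  · obtain ⟨t, ht, e⟩ := h2
    exact ⟨t, Or.inr (Or.inl ⟨h1, ⟨t, ht, e⟩, ht, e⟩)⟩
  · obtain ⟨t, ht⟩ := h h1 h2
    exact ⟨t, Or.inr (Or.inr ⟨h1, h2, Or.inl ht⟩)⟩

/-- The sign of the mixed coefficient is that of the cross product of the tangents. -/
lemma bend_im_eq_tangent {σ γ : Arc} {s : ℝ} (h : γ 0 = σ s) :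
    ∃ c : ℝ, 0 < c ∧ (σ.bend γ).im = c * (γ.tangent 0 * conj (σ.tangent s)).im := by
  have h1 := γ.norm_sub_pos
  have h2 := σ.norm_sub_pos
  refine ⟨‖γ 1 - γ 0‖ * ‖σ 1 - σ 0‖, by positivity, ?_⟩
  rw [bend_im_eq_cross h, tangent_eq_chordDir, tangent_eq_chordDir, map_mul, Complex.conj_ofReal,
    mul_mul_mul_comm, ← Complex.ofReal_mul, Complex.im_ofReal_mul]
  field_simp

/-- Among unit vectors to the left of both `τ` and `u`, the vector `u` makes the smallest angle
with `τ`. -/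
lemma inner_le_of_cross {τ u v : ℂ} (hτ : ‖τ‖ = 1) (hu : ‖u‖ = 1) (hv : ‖v‖ = 1)
    (h1 : 0 < (u * conj τ).im) (h2 : 0 ≤ (v * conj τ).im) (h3 : 0 ≤ (v * conj u).im) :
    Inner.inner ℝ τ v ≤ (Inner.inner ℝ τ u : ℝ) ∧
      ((Inner.inner ℝ τ u : ℝ) ≤ Inner.inner ℝ τ v → v = u) := by
  have hi : ∀ w : ℂ, (Inner.inner ℝ τ w : ℝ) = (w * conj τ).re := fun w => by
    rw [Complex.inner, mul_comm]
  have hττ : conj τ * τ = 1 := by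
    rw [mul_comm, Complex.mul_conj', hτ]; simp
  have hn : ∀ w : ℂ, ‖w‖ = 1 → (w * conj τ).re ^ 2 + (w * conj τ).im ^ 2 = 1 := fun w hw => by
    have : Complex.normSq (w * conj τ) = 1 := by
      rw [Complex.normSq_eq_norm_sq, norm_mul, Complex.norm_conj, hw, hτ]; norm_num
    rw [Complex.normSq_apply] at this
    linarith
  -- After rotating `τ` to 1, both vectors lie on the closed upper unit half-circle, and the cross
  -- product says that `v` comes after `u` counterclockwise.
  have h3' : 0 ≤ (v * conj τ).im * (u * conj τ).re - (v * conj τ).re * (u * conj τ).im := by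
    have : v * conj u = (v * conj τ) * conj (u * conj τ) := by
      rw [map_mul, Complex.conj_conj]
      linear_combination -v * conj u * hττ
    rw [this, Complex.mul_im, Complex.conj_im, Complex.conj_re] at h3
    linarith
  have nu := hn u hu
  have nv := hn v hv
  have hle : (v * conj τ).re ≤ (u * conj τ).re := by
    by_contra! hc
    rcases le_or_gt 0 (u * conj τ).re with h | h
    · have h4 : (v * conj τ).im < (u * conj τ).im := by nlinarith
      nlinarith
    · have h5 : (v * conj τ).re ≤ 0 := by
        by_contra! h6
        nlinarith [mul_pos h6 h1]
      have h4 : (u * conj τ).im < (v * conj τ).im := by nlinarith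
      nlinarith [mul_pos (neg_pos.2 h) (sub_pos.2 h4), mul_pos (sub_pos.2 hc) h1]
  rw [hi, hi]
  refine ⟨hle, fun hge => ?_⟩
  have hre := le_antisymm hle hge
  have him : (v * conj τ).im = (u * conj τ).im := by
    rw [hre] at nv
    exact (pow_left_inj₀ h2 h1.le two_ne_zero).1 (by linarith)
  have := Complex.ext hre him
  linear_combination τ * this - (v - u) * hττ

/-! ### Extremality of the arc through the endpoints. -/

section through

variable {σ γ : Arc} {p : ℂ} {k : ℝ}

/-- Along a connecting arc, every point beyond the circle of `σ` lies left of `γ`. -/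
lemma ratio_nonneg_of_mem_arcClosure (h0 : γ 0 = σ 0) (h1 : γ 1 = p) (hkp : 0 < k)
    (hk : cis (-γ.ang) = k * (conj (p - σ 1) * (σ 1 - σ 0))) (hp : (σ.side p).im < 0) {δ : Arc}
    (hδ : δ ∈ arcClosure (σ.connectingStar p)) {l : ℝ}
    (hl : (σ.bend δ).im + (σ.side p).im * l < 0) (hl0 : 0 < l) :
    0 ≤ (γ.side (δ 0)).im + (γ.bend δ).im * l := by
  obtain ⟨d0, d1, -⟩ := mem_arcClosure_star hδ
  have hs0 := side_im_of_mem_image d0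
  have hend : (γ.side (δ 1)).im = 0 := by rw [d1, ← h1, side_end, Complex.zero_im]
  obtain ⟨t, ht, hw⟩ := δ.exists_wt_eq hl0.le
  have a := δ.wt_pos (t := 1 - t) (by linarith [ht.2]) (by linarith [ht.1])
  -- The alternative with weak inequalities is closed, so it passes from narrow connecting arcs to
  -- their limits.
  have hC : IsClosed {z : ℂ × ℂ × ℂ | 0 ≤ (σ.side z.2.1).im ∨ 0 ≤ (γ.side z.2.1).im} := by
    have c1 := σ.continuous_side
    have c2 := γ.continuous_side
    have c3 : Continuous fun z : ℂ × ℂ × ℂ => (σ.side z.2.1).im := by fun_prop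
    have c4 : Continuous fun z : ℂ × ℂ × ℂ => (γ.side z.2.1).im := by fun_prop
    exact (isClosed_le continuous_const c3).union (isClosed_le continuous_const c4)
  have := mem_of_mem_arcClosure hδ hC ⟨ht.1, ht.2.le⟩ fun δ' hδ' =>
    side_nonneg_of_mem_star h0 h1 hkp hk hp hδ' ⟨ht.1, ht.2.le⟩
  rw [mem_ofPred_eq] at this
  have hneg : (σ.side (δ t)).im < 0 := by
    rw [side_path_im_of_start hs0, d1, hw]
    have : l * δ.wt (1 - t) * ((σ.bend δ).im * δ.wt (1 - t) + (σ.side p).im * (l * δ.wt (1 - t))) =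
      (l * δ.wt (1 - t) ^ 2) * ((σ.bend δ).im + (σ.side p).im * l) := by ring
    rw [this]
    exact mul_neg_of_pos_of_neg (by positivity) hl
  have h2 := this.resolve_left (not_le.2 hneg)
  rw [side_path_im_of_end hend, hw] at h2
  have e : δ.wt (1 - t) * ((γ.side (δ 0)).im * δ.wt (1 - t) + (γ.bend δ).im * (l * δ.wt (1 - t))) =
      δ.wt (1 - t) ^ 2 * ((γ.side (δ 0)).im + (γ.bend δ).im * l) := by ring
  rw [e] at h2
  exact nonneg_of_mul_nonneg_right h2 (by positivity)

/-- The mixed coefficient of `γ` along a connecting arc with the same starting point. -/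
lemma bend_nonneg_of_start_eq (h0 : γ 0 = σ 0) (h1 : γ 1 = p) (hkp : 0 < k)
    (hk : cis (-γ.ang) = k * (conj (p - σ 1) * (σ 1 - σ 0))) (hp : (σ.side p).im < 0) {δ : Arc}
    (hδ : δ ∈ arcClosure (σ.connectingStar p)) (hs : δ 0 = σ 0) : 0 ≤ (γ.bend δ).im := by
  obtain ⟨-, -, hb⟩ := mem_arcClosure_star hδ
  have hl0 : 0 ≤ (σ.bend δ).im / -(σ.side p).im := div_nonneg hb (neg_pos.2 hp).le
  set l := (σ.bend δ).im / -(σ.side p).im with hl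
  have hlβ : (σ.bend δ).im = l * -(σ.side p).im := by
    rw [hl, div_mul_cancel₀ _ (neg_pos.2 hp).ne']
  -- Any ratio strictly beyond `l` would do. At a common start the constant term vanishes, which
  -- leaves the sign of the slope.
  have := ratio_nonneg_of_mem_arcClosure h0 h1 hkp hk hp hδ (l := l + 1)
    (by rw [hlβ]; linarith) (by linarith)
  rw [hs, ← h0, side_start, Complex.zero_im, zero_add] at this
  exact nonneg_of_mul_nonneg_left this (by linarith)

/-- A connecting arc that starts at an inner point of `σ` meets the arc through the endpoints. -/
lemma exists_meet (h0 : γ 0 = σ 0) (h1 : γ 1 = p) (hkp : 0 < k)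
    (hk : cis (-γ.ang) = k * (conj (p - σ 1) * (σ 1 - σ 0))) (hp : (σ.side p).im < 0) {δ : Arc}
    (hδ : δ ∈ arcClosure (σ.connectingStar p)) (hneg : (γ.side (δ 0)).im < 0) :
    ∃ t ∈ Ioo (0 : ℝ) 1, δ t ∈ γ.image := by
  obtain ⟨d0, d1, hb⟩ := mem_arcClosure_star hδ
  have hs0 := side_im_of_mem_image d0
  have hend : (γ.side (δ 1)).im = 0 := by rw [d1, ← h1, side_end, Complex.zero_im]
  set l := (σ.bend δ).im / -(σ.side p).im with hl
  have hl0 : 0 ≤ l := div_nonneg hb (neg_pos.2 hp).le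
  have hlβ : (σ.bend δ).im = l * -(σ.side p).im := by
    rw [hl, div_mul_cancel₀ _ (neg_pos.2 hp).ne']
  -- The bound holds strictly beyond the crossing ratio `l` and extends to `l` by continuity.
  have hle : 0 ≤ (γ.side (δ 0)).im + (γ.bend δ).im * l := by
    have hc : Tendsto (fun l' => (γ.side (δ 0)).im + (γ.bend δ).im * l') (𝓝[>] l)
        (𝓝 ((γ.side (δ 0)).im + (γ.bend δ).im * l)) :=
      ((by fun_prop : Continuous fun l' => (γ.side (δ 0)).im + (γ.bend δ).im * l').tendsto
        l).mono_left nhdsWithin_le_nhds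
    refine ge_of_tendsto hc ?_
    filter_upwards [self_mem_nhdsWithin] with l' hl'
    have hl' : l < l' := hl'
    exact ratio_nonneg_of_mem_arcClosure h0 h1 hkp hk hp hδ (by rw [hlβ]; nlinarith) (by linarith)
  have hβ2 : 0 < (γ.bend δ).im := by
    by_contra! h
    nlinarith
  -- The ratio at which `δ` reaches the circle or line of `γ`. As `m ≤ l`, the point is not strictly
  -- right of `σ`, hence on `γ` itself.
  set m := -(γ.side (δ 0)).im / (γ.bend δ).im with hm
  have hm0 : 0 < m := div_pos (neg_pos.2 hneg) hβ2
  have hml : m ≤ l := by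
    rw [hm, div_le_iff₀ hβ2]; linarith
  have hmβ : (γ.side (δ 0)).im = -(m * (γ.bend δ).im) := by
    rw [hm, div_mul_cancel₀ _ hβ2.ne', neg_neg]
  obtain ⟨t, ht, hw⟩ := δ.exists_wt_eq hm0.le
  have ht0 : 0 < t := lt_of_le_of_ne ht.1 (by rintro rfl; simp at hw; exact hm0.ne hw)
  have a := δ.wt_pos (t := 1 - t) (by linarith [ht.2]) (by linarith)
  refine ⟨t, ⟨ht0, ht.2⟩, mem_image_through h0 h1 hkp hk hp ?_ ?_⟩
  · rw [side_path_im_of_end hend, hw, hmβ]; ring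
  · rw [side_path_im_of_start hs0, d1, hw, hlβ]
    have : m * δ.wt (1 - t) * (l * -(σ.side p).im * δ.wt (1 - t) +
        (σ.side p).im * (m * δ.wt (1 - t))) =
      (m * δ.wt (1 - t) ^ 2) * (-(σ.side p).im * (l - m)) := by ring
    rw [this]
    exact mul_nonneg (by positivity) (mul_nonneg (neg_pos.2 hp).le (by linarith))

/-- The arc through the endpoints of `σ` is a limit of connecting arcs in the narrow sense. -/
lemma through_mem_arcClosure (h0 : γ 0 = σ 0) (h1 : γ 1 = p) (hkp : 0 < k)
    (hk : cis (-γ.ang) = k * (conj (p - σ 1) * (σ 1 - σ 0))) (hp : (σ.side p).im < 0) :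
    γ ∈ arcClosure (σ.connectingStar p) := by
  obtain ⟨ha, hslit⟩ := ang_eq_of_cis hkp hk
  have hcp := σ.continuous_path
  have hcc := Complex.continuous_conj
  have hw : Continuous (fun s : ℝ => conj (p - σ (1 + s)) * (σ (1 + s) - σ s)) := by fun_prop
  -- The approximating arcs start at `σ s` and pass through `σ (1 + s)`, just beyond the end. They
  -- thus leave to the left and return to the circle or line of `σ` only off `σ`.
  refine mem_arcClosure_of_continuousAt (x := fun s => σ s)
    (φ := fun s => -(conj (p - σ (1 + s)) * (σ (1 + s) - σ s)).arg) hcp.continuousAt ?_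
    h0.symm (by simpa using ha.symm) ?_
  · exact (ContinuousAt.comp (g := Complex.arg)
      (Complex.continuousAt_arg (by simpa using hslit)) hw.continuousAt).neg
  have e1 : ∀ᶠ s in 𝓝[>] (0 : ℝ),
      conj (p - σ (1 + s)) * (σ (1 + s) - σ s) ∈ Complex.slitPlane :=
    (hw.continuousAt.eventually_mem
      (Complex.isOpen_slitPlane.mem_nhds (by simpa using hslit))).filter_mono nhdsWithin_le_nhds
  -- This keeps `σ (1 + s)` from running around the circle back onto `σ`: its `side` is a negative
  -- multiple of `wt (1 + s) * wt (-s)`.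
  have e2 : ∀ᶠ s in 𝓝[>] (0 : ℝ), 0 < σ.wt (1 + s) := by
    have hc : Continuous fun s : ℝ => σ.wt (1 + s) := by
      have := σ.continuous_wt
      fun_prop
    exact (hc.continuousAt.eventually (lt_mem_nhds (by simp))).filter_mono nhdsWithin_le_nhds
  filter_upwards [e1, e2, Ioo_mem_nhdsGT zero_lt_one] with s hs hws hs1
  have hne : σ s ≠ p := by
    intro h
    exact hp.ne (side_im_of_mem_carrier (γ := σ) ⟨s, h⟩)
  obtain ⟨δ, d0, d1, da, u, hu, hy⟩ := exists_arc_through hne hs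
  have hs0 : (σ.side (δ 0)).im = 0 := d0 ▸ side_im_of_mem_carrier ⟨_, rfl⟩
  have hyim : (σ.side (δ u)).im = 0 := hy ▸ side_im_of_mem_carrier ⟨_, rfl⟩
  have hynot : δ u ∉ σ.image := by
    rw [hy, mem_image_iff, side_self, not_and, not_le, Complex.ofReal_re]
    intro _
    have : 1 - (1 + s) = -s := by ring
    rw [this, wt_neg]
    have := σ.wt_pos hs1.1 hs1.2.le
    have := pow_pos σ.norm_sub_pos 2
    have : 0 < ‖σ 1 - σ 0‖ ^ 2 * (σ.wt (1 + s) * σ.wt s) := by positivity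
    linarith
  have hu0 : 0 < u := by
    refine lt_of_le_of_ne hu.1 ?_
    rintro rfl
    exact hynot (d0 ▸ ⟨s, ⟨hs1.1.le, hs1.2.le⟩, rfl⟩)
  have hu1 : u < 1 := by
    refine lt_of_le_of_ne hu.2 ?_
    rintro rfl
    rw [d1] at hyim
    exact hp.ne hyim
  have a := δ.wt_pos (t := 1 - u) (by linarith) (by linarith)
  have b := δ.wt_pos hu0 hu1.le
  rw [side_path_im_of_start hs0, d1] at hyim
  have hz := (mul_eq_zero.1 hyim).resolve_left b.ne'
  have hβ : 0 < (σ.bend δ).im := by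
    by_contra! h
    nlinarith
  refine ⟨δ, mem_connectingStar hs1 d0 d1 ?_ ?_, d0, by rw [d1, h1], da⟩
  · intro t ht hmem
    have htim := side_im_of_mem_image hmem
    have b' := δ.wt_pos ht.1 ht.2
    rw [side_path_im_of_start hs0, d1] at htim
    have hz' := (mul_eq_zero.1 htim).resolve_left b'.ne'
    have hcr : δ.wt t * δ.wt (1 - u) = δ.wt u * δ.wt (1 - t) := by
      apply mul_left_cancel₀ hβ.ne'
      linear_combination δ.wt t * hz - δ.wt u * hz'
    rcases lt_trichotomy t u with h | rfl | h
    · exact (δ.wt_mul_lt h (by linarith [ht.1])).ne hcr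
    · exact hynot hmem
    · exact (δ.wt_mul_lt h (by linarith [ht.2])).ne' hcr
  · have hc : Continuous fun t => (σ.bend δ).im * δ.wt (1 - t) + (σ.side (δ 1)).im * δ.wt t := by
      have := δ.continuous_wt
      fun_prop
    have e3 := (hc.continuousAt (x := 0)).eventually (lt_mem_nhds (a := 0) (by simpa using hβ))
    filter_upwards [e3.filter_mono nhdsWithin_le_nhds, Ioo_mem_nhdsGT zero_lt_one] with t ht ht1
    rw [side_path_im_of_start hs0]
    exact mul_pos (δ.wt_pos ht1.1 ht1.2.le) ht

end through

/-- Since `γ` starts at `σ 0`, all other starting points come later, and `γ` is larger because it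
cuts those arcs. For arcs from `σ 0` the initial directions are compared by cross products. -/
theorem isMaximalConnecting_through {σ γ : Arc} {p : ℂ} (hp : p ∉ σ.image)
    (hr : StrictlyRight p σ) (hγ : IsArcThrough (σ 0) (σ 1) p γ) :
    σ.IsMaximalConnecting p γ := by
  obtain ⟨h0, h1, hmem⟩ := hγ
  have hxy := σ.start_ne_end
  have hyp : σ 1 ≠ p := fun h => hp (h ▸ σ.end_mem_image)
  have hneg := (strictlyRight_iff _ _).1 hr
  have hc : p ∉ σ.carrier := fun h => hneg.ne (side_im_of_mem_carrier h)
  obtain ⟨k, hkp, hk⟩ := cis_neg_ang_of_mem (h0 ▸ hxy.symm) (h1 ▸ hyp) hmem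
  rw [h0, h1] at hk
  have hclos : ∀ {γ'}, γ' ∈ σ.connecting p → γ' ∈ arcClosure (σ.connectingStar p) := by
    rintro γ' (⟨-, h⟩ | ⟨h, -⟩)
    · exact h
    · exact absurd h hc
  have hin : ∀ {γ'}, γ' ∈ σ.connecting p → γ' 0 = σ 0 →
      Inner.inner ℝ (σ.tangent 0) (γ'.tangent 0) ≤
        (Inner.inner ℝ (σ.tangent 0) (γ.tangent 0) : ℝ) ∧
      ((Inner.inner ℝ (σ.tangent 0) (γ.tangent 0) : ℝ) ≤
        Inner.inner ℝ (σ.tangent 0) (γ'.tangent 0) → γ'.tangent 0 = γ.tangent 0) := by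
    intro γ' hγ' hs
    obtain ⟨-, d1, hb⟩ := mem_arcClosure_star (hclos hγ')
    have hb2 := bend_nonneg_of_start_eq h0 h1 hkp hk hneg (hclos hγ') hs
    obtain ⟨c1, hc1, e1⟩ := bend_im_eq_tangent h0
    obtain ⟨c2, hc2, e2⟩ := bend_im_eq_tangent hs
    obtain ⟨c3, hc3, e3⟩ := bend_im_eq_tangent (hs.trans h0.symm)
    rw [e2] at hb
    rw [e3] at hb2
    refine inner_le_of_cross (σ.norm_tangent 0) (γ.norm_tangent 0) (γ'.norm_tangent 0) ?_
      (nonneg_of_mul_nonneg_right hb hc2) (nonneg_of_mul_nonneg_right hb2 hc3)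
    refine (mul_pos_iff_of_pos_left hc1).1 ?_
    rw [← e1]
    -- The linear form of `σ.side` along `γ` vanishes at `σ 1` and is negative at `p`, so `γ` leaves
    -- `σ 0` strictly to the left of the tangent of `σ`.
    obtain ⟨t, ht, hy⟩ := hmem
    have ht0 : 0 < t := lt_of_le_of_ne ht.1 (by rintro rfl; exact hxy (h0.symm.trans hy))
    have ht1 : t < 1 := lt_of_le_of_ne ht.2 (by rintro rfl; exact hyp (hy.symm.trans h1))
    have a := γ.wt_pos (t := 1 - t) (by linarith) (by linarith)
    have b := γ.wt_pos ht0 ht1.le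
    have hz : (σ.side (γ t)).im = 0 := by rw [hy, side_end, Complex.zero_im]
    rw [side_path_im_of_start (by rw [h0, side_start, Complex.zero_im]), h1] at hz
    have hz' := (mul_eq_zero.1 hz).resolve_left b.ne'
    by_contra! h
    nlinarith
  have hcut : ∀ {γ'}, γ' ∈ σ.connecting p → γ' 0 ≠ σ 0 →
      σ.Prec (γ 0) (γ' 0) ∧ γ.extCutsFromLeft γ' ≠ ∅ := by
    intro γ' hγ' hs
    obtain ⟨⟨s, hs01, hs'⟩, d1, -⟩ := mem_arcClosure_star (hclos hγ')
    have hs0 : 0 < s := lt_of_le_of_ne hs01.1 (by rintro rfl; exact hs hs'.symm)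
    refine ⟨⟨0, by simp, s, hs01, h0.symm, hs', hs0⟩, extCutsFromLeft_ne_empty fun g1 g2 => ?_⟩
    -- An arc starting at `σ 1` starts on `γ`, a case already settled by the convention for extended
    -- cuts.
    have hs1 : s < 1 := by
      refine lt_of_le_of_ne hs01.2 ?_
      rintro rfl
      exact g2 (hs' ▸ hmem)
    have hside : (γ.side (γ' 0)).im < 0 := by
      rw [← hs', side_im_through_of_im_eq_zero h0 h1 hk (side_im_of_mem_carrier ⟨s, rfl⟩),
        side_self, Complex.ofReal_re]
      have a := σ.wt_pos (t := 1 - s) (by linarith) (by linarith)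
      have b := σ.wt_pos hs0 hs1.le
      have c := pow_pos σ.norm_sub_pos 2
      have := mul_pos hkp (mul_pos (neg_pos.2 hneg) (mul_pos c (mul_pos b a)))
      linarith
    obtain ⟨t, ht, u, hu, he⟩ := exists_meet h0 h1 hkp hk hneg (hclos hγ') hside
    have d1' : γ' 1 = γ 1 := d1.trans h1.symm
    refine ⟨u, mem_cutsFromLeft_of_meet d1' ht ⟨?_, ?_⟩ he.symm hside⟩
    · refine lt_of_le_of_ne hu.1 ?_
      rintro rfl
      exact g1 ⟨t, ⟨ht.1.le, ht.2.le⟩, he.symm⟩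
    · refine lt_of_le_of_ne hu.2 ?_
      rintro rfl
      exact ht.2.ne (γ'.path_injOn ⟨ht.1.le, ht.2.le⟩ (by simp) (he.symm.trans d1'.symm))
  refine ⟨Or.inl ⟨hc, through_mem_arcClosure h0 h1 hkp hk hneg⟩, fun γ' hγ' => ?_,
    fun γ' hγ' hle => ?_⟩
  · by_cases hs : γ' 0 = σ 0
    · exact Or.inr (Or.inr ⟨0, by simp, hs, h0, (hin hγ' hs).1⟩)
    · exact Or.inr (Or.inl (hcut hγ' hs))
  · by_cases hs : γ' 0 = σ 0
    · rcases hle with ⟨h, -⟩ | ⟨h, -⟩ | ⟨t, ht, e, -, hle⟩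
      · exact absurd (hs ▸ h) not_prec_start
      · exact absurd (h0 ▸ h) not_prec_start
      · obtain rfl : t = 0 := σ.path_injOn ht (by simp) (e.symm.trans h0)
        exact IsArcWithTangent.unique ⟨hs, (start_end_of_mem_connecting hγ').2, (hin hγ' hs).2 hle⟩
          ⟨h0, h1, rfl⟩
    · obtain ⟨g1, g2⟩ := hcut hγ' hs
      rcases hle with ⟨-, h⟩ | ⟨h, -⟩ | ⟨t, ht, e, e', -⟩
      · exact absurd h g2
      · exact absurd (h0 ▸ h) not_prec_start
      · exact absurd (e'.trans (e.symm.trans h0)) hs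

end Arc

end CircVis

/-! ### The proposition. -/

theorem mainTheorem6 (σ : CircVis.Arc) (p : ℂ) (hp : p ∉ σ.image) :
    ((CircVis.Arc.StrictlyLeft p σ ∨ p ∈ σ.carrier) →
      σ.tangent 1 ≠ (‖σ 1 - p‖⁻¹ : ℝ) • (σ 1 - p) →
      ∃ γ : CircVis.Arc,
        CircVis.Arc.IsArcWithTangent (σ.tangent 1) (σ 1) p γ ∧
        (∀ γ', CircVis.Arc.IsArcWithTangent (σ.tangent 1) (σ 1) p γ' → γ' = γ) ∧
        σ.IsMaximalConnecting p γ) ∧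
    (CircVis.Arc.StrictlyRight p σ →
      p ∉ segment ℝ (σ 0) (σ 1) → σ 0 ∉ segment ℝ p (σ 1) →
      ∃ γ : CircVis.Arc,
        CircVis.Arc.IsArcThrough (σ 0) (σ 1) p γ ∧
        (∀ γ', CircVis.Arc.IsArcThrough (σ 0) (σ 1) p γ' → γ' = γ) ∧
        σ.IsMaximalConnecting p γ) := by
  have hyp : σ 1 ≠ p := fun h => hp (h ▸ σ.end_mem_image)
  have hxp : σ 0 ≠ p := fun h => hp (h ▸ σ.start_mem_image)
  constructor
  · intro hp0 ht
    obtain ⟨γ, hγ⟩ := CircVis.Arc.exists_isArcWithTangent hp ht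
    exact ⟨γ, hγ, fun γ' hγ' => hγ'.unique hγ,
      CircVis.Arc.isMaximalConnecting_tangential hp hp0 hγ⟩
  · intro hr hs1 hs2
    obtain ⟨γ, h0, h1, -, hmem⟩ := CircVis.Arc.exists_arc_through hxp
      (CircVis.Arc.slitPlane_of_notMem_segment σ.start_ne_end hs1 hs2)
    have hγ : CircVis.Arc.IsArcThrough (σ 0) (σ 1) p γ := ⟨h0, h1, hmem⟩
    exact ⟨γ, hγ, fun γ' hγ' => hγ'.unique σ.start_ne_end hyp hγ,
      CircVis.Arc.isMaximalConnecting_through hp hr hγ⟩
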